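/- **Theorem.** The principle $\mathrm{Pr}_1(\aleph_2,\aleph_2,\aleph_2,\aleph_0)$ holds: there is a symmetric function $c:\omega_2\times\omega_2\to\omega_2$ such that for every sequence $\langle u_\alpha:\alpha<\omega_2\rangle$ of pairwise disjoint finite subsets of $\omega_2$ and every $\gamma<\omega_2$ there are $\alpha<\beta<\omega_2$ with $c(\zeta,\xi)=\gamma$ for all $\zeta\in u_\alpha$ and $\xi\in u_\beta$. Consequently the $\aleph_2$-chain condition is not productive. Here the cellularity of a topological space (of a Boolean algebra) is the supremum of the cardinalities of its families of pairwise disjoint nonempty open sets (of pairwise disjoint nonzero elements), and the $\aleph_2$-c.c. says that every such family has cardinality less than $\aleph_2$. 1. There are topological spaces $X,Y$ of cellularity $\aleph_1$ whose product $X\times Y$ has cellularity $\aleph_2$; moreover $X$ and $Y$ satisfy the $\aleph_2$-c.c. and $X\times Y$ does not. 2. There are Boolean algebras $A,B$ of cellularity $\aleph_1$ whose free product (the coproduct in the category of Boolean algebras) has cellularity $\aleph_2$; moreover $A$ and $B$ satisfy the $\aleph_2$-c.c. and their free product does not. -/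

import Mathlib

universe u

/-- The colouring principle `Pr₁(λ, μ, θ, σ)`: there is a symmetric two-place function `d` from
`λ` to `θ` such that for every sequence `⟨u α : α < μ⟩` of pairwise disjoint subsets of `λ` of
cardinality `< σ` and every colour `γ < θ`, there are `α < β < μ` such that `d` is constantly `γ`
on `u α × u β`. A cardinal `κ` is represented by the well-ordered type `κ.ord.ToType`
of all ordinals below it. -/
def Pr1 (lam mu theta sigma : Cardinal.{u}) : Prop :=
  ∃ d : lam.ord.ToType → lam.ord.ToType → theta.ord.ToType,
    (∀ ζ ξ, d ζ ξ = d ξ ζ) ∧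
    ∀ u : mu.ord.ToType → Set lam.ord.ToType,
      (∀ α, Cardinal.mk (u α) < sigma) →
      (∀ α β, α < β → Disjoint (u α) (u β)) →
      ∀ γ : theta.ord.ToType,
        ∃ α β, α < β ∧ ∀ ζ ∈ u α, ∀ ξ ∈ u β, d ζ ξ = γ

/-- A family of pairwise disjoint nonzero elements. -/
def IsCellularFamily {α : Type u} [PartialOrder α] [OrderBot α] (S : Set α) : Prop :=
  ⊥ ∉ S ∧ S.PairwiseDisjoint id

/-- The cellularity: the supremum of the cardinalities of the families of pairwise disjoint
nonzero elements. -/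
noncomputable def cellularity (α : Type u) [PartialOrder α] [OrderBot α] : Cardinal.{u} :=
  ⨆ S : {S : Set α // IsCellularFamily S}, Cardinal.mk S.1

/-- The `κ`-chain condition: every family of pairwise disjoint nonzero elements has
cardinality less than `κ`. -/
def ChainCondition (κ : Cardinal.{u}) (α : Type u) [PartialOrder α] [OrderBot α] : Prop :=
  ∀ S : Set α, IsCellularFamily S → Cardinal.mk S < κ

/-- The cellularity of a topological space: the supremum of the cardinalities of the families
of pairwise disjoint nonempty open sets. -/
noncomputable def spaceCellularity (X : Type u) [TopologicalSpace X] : Cardinal.{u} :=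
  cellularity (TopologicalSpace.Opens X)

/-- The `κ`-chain condition of a topological space: every family of pairwise disjoint nonempty
open sets has cardinality less than `κ`. -/
def SpaceChainCondition (κ : Cardinal.{u}) (X : Type u) [TopologicalSpace X] : Prop :=
  ChainCondition κ (TopologicalSpace.Opens X)

/-- `C`, with the homomorphisms `i` and `j`, is the free product (coproduct) of the Boolean
algebras `A` and `B`. Lattice homomorphisms between Boolean algebras that preserve `⊥` and `⊤`
are exactly the Boolean homomorphisms. -/
def IsFreeProduct {A B C : Type u} [BooleanAlgebra A] [BooleanAlgebra B] [BooleanAlgebra C]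
    (i : BoundedLatticeHom A C) (j : BoundedLatticeHom B C) : Prop :=
  ∀ (D : Type u) [BooleanAlgebra D] (f : BoundedLatticeHom A D) (g : BoundedLatticeHom B D),
    ∃! h : BoundedLatticeHom C D, h.comp i = f ∧ h.comp j = g

/-! The colouring comes from minimal walks. Every ξ < ω₂ is enumerated in type ω₁. The walk from ξ
down to ζ moves from η to the first enumerated point that is ≥ ζ and records its index; the finite
set of recorded indices is the trace. If δ has uncountable cofinality, each step towards δ skips
only countably many points, so walks to all ζ close below δ pass through δ
(`WalkData.exists_passes`). A colouring `d` of the finite subsets of ω₁ turns the trace into some ν,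
and the walk is stopped at its first point with index above ν. The colour is `h` of that point,
where `h` splits the points of uncountable cofinality into ω₂ stationary sets.

Given disjoint finite sets and γ, pressing down yields a stationary T inside `h = γ` and one ν
bounding the indices on walks from chosen sets above δ ∈ T down to δ. By `exists_two_sided_index`
some δ ∈ T has uncountably many j that are both the index of a step from some δ₀ ∈ T towards δ and
the index of the step from δ towards whole sets below it. Walks through δ have as trace a union of
an upper and a lower part. `exists_finset_colouring` makes `d` equal to ν on all unions of upper
parts marked i and lower parts marked j, for some i < j. The walks then stop at the δ₀ of i, where
`h` is γ.

For `d`, points of ω₁ are viewed as distinct reals. The pair of longest agreement in a union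
straddles a given δ, and finite-to-one functions on initial segments recover δ from it.

Two colours give edge-disjoint graphs in which any ω₂ disjoint finite sets include two that are
completely joined. By a Δ-system argument the finite cliques of each graph yield the ℵ₂-c.c., with
ℵ₁ isolated vertices forcing cellularity ℵ₁. In the product the pairs of cliques both containing x,
for varying x, are disjoint, since no pair x ≠ y is adjacent in both graphs. -/

open Cardinal Set
open scoped TensorProduct

/-! ### Successor-cardinal orders and closure points -/

/-- A linear order that behaves like the successor cardinal of `κ`: a well-order of cardinality
at most `κ⁺` with initial segments of size at most `κ`, in which all sets of size at most `κ`
are strictly bounded. -/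
structure IsSuccCardOrder (κ : Cardinal.{0}) (W : Type) [LinearOrder W] : Prop where
  wf : WellFoundedLT W
  aleph0_le : ℵ₀ ≤ κ
  card_le : #W ≤ Order.succ κ
  card_Iic_le : ∀ x : W, #(Iic x) ≤ κ
  exists_gt : ∀ s : Set W, #s ≤ κ → ∃ b, ∀ x ∈ s, x < b

theorem isSuccCardOrder_ord_toType {κ lam : Cardinal.{0}} (hκ : ℵ₀ ≤ κ)
    (h : lam = Order.succ κ) : IsSuccCardOrder κ lam.ord.ToType := by
  have hreg : lam.IsRegular := h ▸ isRegular_succ hκ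
  refine ⟨inferInstance, hκ, by simp [h], fun x => ?_, fun s hs => ?_⟩
  · have h1 : #(Iio x) ≤ κ := by
      have := mk_Iio_lt x (by simp)
      exact Order.lt_succ_iff.1 (this.trans_eq ((mk_ord_toType lam).trans h))
    rw [← Iio_insert]
    refine mk_insert_le.trans ?_
    exact add_le_of_le hκ h1 (one_le_aleph0.trans hκ)
  · by_contra hcon
    push Not at hcon
    have hc : IsCofinal s := fun b => by
      obtain ⟨x, hx, hb⟩ := hcon b
      exact ⟨x, hx, hb⟩
    have h1 := Order.cof_le hc
    rw [Ordinal.cof_toType, hreg.cof_ord] at h1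
    exact (Order.lt_succ κ).not_ge (h.ge.trans (h1.trans hs))

/-- `δ` is a closure point of the function `F`. -/
def IsClosurePoint {W : Type} [LinearOrder W] (F : W → W) (δ : W) : Prop := ∀ x < δ, F x < δ

/-- A set is stationary if it contains arbitrarily large closure points of every function. -/
def IsStat {W : Type} [LinearOrder W] (A : Set W) : Prop :=
  ∀ (F : W → W) (x₀ : W), ∃ δ ∈ A, x₀ < δ ∧ IsClosurePoint F δ

namespace IsSuccCardOrder

variable {κ : Cardinal.{0}} {W : Type} [LinearOrder W]

theorem exists_gt_range (hW : IsSuccCardOrder κ W) {ι : Type} (f : ι → W) (hι : #ι ≤ κ) :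
    ∃ b, ∀ i, f i < b := by
  obtain ⟨b, hb⟩ := hW.exists_gt (range f) (mk_range_le.trans hι)
  exact ⟨b, fun i => hb _ ⟨i, rfl⟩⟩

theorem exists_gt' (hW : IsSuccCardOrder κ W) (x : W) : ∃ b, x < b := by
  obtain ⟨b, hb⟩ := hW.exists_gt {x} (by simpa using one_le_aleph0.trans hW.aleph0_le)
  exact ⟨b, hb x rfl⟩

theorem nonempty (hW : IsSuccCardOrder κ W) : Nonempty W := by
  obtain ⟨b, -⟩ := hW.exists_gt ∅ (by simp)
  exact ⟨b⟩

/-- There is a function whose closure points are closed under `κ` many prescribed values. -/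
theorem exists_closure (hW : IsSuccCardOrder κ W) (P : W → Set W) (hP : ∀ z, #(P z) ≤ κ) :
    ∃ F : W → W, ∀ δ, IsClosurePoint F δ → ∀ z < δ, ∀ p ∈ P z, p < δ := by
  choose F hF using fun z => hW.exists_gt (P z) (hP z)
  exact ⟨F, fun δ hδ z hz p hp => (hF z p hp).trans (hδ z hz)⟩

theorem exists_closure_family (hW : IsSuccCardOrder κ W) {ι : Type} (hι : #ι ≤ κ)
    (G : ι → W → W) :
    ∃ F : W → W, ∀ δ, IsClosurePoint F δ → ∀ i, IsClosurePoint (G i) δ := by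
  obtain ⟨F, hF⟩ := hW.exists_closure (fun z => range fun i => G i z)
    fun z => mk_range_le.trans hι
  exact ⟨F, fun δ hδ i x hx => hF δ hδ x hx _ ⟨i, rfl⟩⟩

theorem exists_closure₂ (hW : IsSuccCardOrder κ W) (G : W → W → W) :
    ∃ F : W → W, ∀ δ, IsClosurePoint F δ → ∀ x < δ, ∀ y < δ, G x y < δ := by
  obtain ⟨F, hF⟩ := hW.exists_closure
    (fun z => range fun p : Iic z × Iic z => G p.1 p.2) fun z => by
      refine mk_range_le.trans ?_
      rw [mk_prod]
      simp only [lift_id]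
      exact mul_le_of_le hW.aleph0_le (hW.card_Iic_le z) (hW.card_Iic_le z)
  exact ⟨F, fun δ hδ x hx y hy =>
    hF δ hδ (max x y) (max_lt hx hy) _ ⟨(⟨x, le_max_left _ _⟩, ⟨y, le_max_right _ _⟩), rfl⟩⟩

theorem exists_isLeast_bound (hW : IsSuccCardOrder κ W) {ι : Type} (hι : #ι ≤ κ) (g : ι → W) :
    ∃ δ, (∀ i, g i < δ) ∧ ∀ x < δ, ∃ i, x ≤ g i := by
  have := hW.wf
  obtain ⟨b, hb⟩ := hW.exists_gt_range g hι
  obtain ⟨δ, hδ, hmin⟩ := exists_minimal_of_wellFoundedLT (fun b => ∀ i, g i < b) ⟨b, hb⟩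
  refine ⟨δ, hδ, fun x hx => ?_⟩
  by_contra hcon
  push Not at hcon
  exact (hmin hcon hx.le).not_gt hx

/-- The supremum of the ω iterates of a monotone-type majorant of `F` is closed under `F`. -/
theorem isStat_univ (hW : IsSuccCardOrder κ W) : IsStat (univ : Set W) := by
  intro F x₀
  obtain ⟨F', hF'⟩ : ∃ F' : W → W, ∀ z, ∀ x ≤ z, F x < F' z := by
    choose F' hF' using fun z => hW.exists_gt_range (fun x : Iic z => F x) (hW.card_Iic_le z)
    exact ⟨F', fun z x hx => hF' z ⟨x, hx⟩⟩
  let g : ℕ → W := fun n => F'^[n] x₀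
  obtain ⟨δ, h1, h2⟩ := hW.exists_isLeast_bound (by simpa using hW.aleph0_le) g
  refine ⟨δ, mem_univ _, h1 0, fun x hx => ?_⟩
  obtain ⟨n, hn⟩ := h2 x hx
  refine (hF' _ x hn).trans ?_
  have := h1 (n + 1)
  simp only [g, Function.iterate_succ_apply'] at this
  exact this

end IsSuccCardOrder

/-! ### Stationary sets: completeness, pressing down, splitting -/

namespace IsStat

variable {κ : Cardinal.{0}} {W : Type} [LinearOrder W]

theorem mono {A B : Set W} (hA : IsStat A) (h : A ⊆ B) : IsStat B := fun F x₀ => by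
  obtain ⟨δ, hδ, h'⟩ := hA F x₀
  exact ⟨δ, h hδ, h'⟩

theorem inter_closurePoints {A : Set W} (hW : IsSuccCardOrder κ W) (hA : IsStat A)
    (F : W → W) (x₀ : W) : IsStat {δ ∈ A | x₀ < δ ∧ IsClosurePoint F δ} := by
  intro G x₁
  obtain ⟨H, hH⟩ := hW.exists_closure_family (ι := Bool)
    ((mk_le_aleph0).trans hW.aleph0_le) (fun b => bif b then F else G)
  obtain ⟨δ, hδ, hx, hc⟩ := hA H (max x₀ x₁)
  exact ⟨δ, ⟨hδ, (le_max_left _ _).trans_lt hx, hH δ hc true⟩, (le_max_right _ _).trans_lt hx,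
    hH δ hc false⟩

/-- If a stationary set is covered by `κ` many sets, then one of them is stationary. -/
theorem exists_of_subset_iUnion (hW : IsSuccCardOrder κ W) {A : Set W} (hA : IsStat A)
    {ι : Type} (hι : #ι ≤ κ) (B : ι → Set W) (h : A ⊆ ⋃ i, B i) : ∃ i, IsStat (B i) := by
  by_contra hcon
  simp only [IsStat] at hcon
  push Not at hcon
  choose F x hF using hcon
  obtain ⟨G, hG⟩ := hW.exists_closure_family hι F
  obtain ⟨b, hb⟩ := hW.exists_gt_range x hι
  obtain ⟨δ, hδ, hbδ, hc⟩ := hA G b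
  obtain ⟨i, hi⟩ := mem_iUnion.1 (h hδ)
  exact hF i δ hi ((hb i).trans hbδ) (hG δ hc i)

/-- The pressing-down lemma of Fodor. -/
theorem fodor (hW : IsSuccCardOrder κ W) {A : Set W} (hA : IsStat A) (P : W → W → Prop)
    (h : ∀ δ ∈ A, ∃ c < δ, P δ c) : ∃ c, IsStat {δ ∈ A | P δ c} := by
  by_contra hcon
  simp only [IsStat] at hcon
  push Not at hcon
  choose F x hF using hcon
  -- Diagonal intersection: a point closed under `x` and under `F` in two variables is, for every
  -- `c` below it, beyond `x c` and closed under `F c`.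
  obtain ⟨G, hG⟩ := hW.exists_closure₂ F
  obtain ⟨G', hG'⟩ := hW.exists_closure_family (ι := Bool)
    ((mk_le_aleph0).trans hW.aleph0_le) (fun b => bif b then G else x)
  obtain ⟨x₀⟩ := hW.nonempty
  obtain ⟨δ, hδ, -, hc⟩ := hA G' x₀
  obtain ⟨c, hcδ, hP⟩ := h δ hδ
  exact hF c δ ⟨hδ, hP⟩ (hG' δ hc false c hcδ)
    fun y hy => hG δ (hG' δ hc true) c hcδ y hy

/-- A stationary set splits into `κ⁺` many stationary sets, by means of an Ulam matrix. -/
theorem exists_partition (hW : IsSuccCardOrder κ W) {S : Set W} (hS : IsStat S) :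
    ∃ h : W → W, ∀ γ, IsStat {δ ∈ S | h δ = γ} := by
  classical
  obtain ⟨w₀⟩ := hW.nonempty
  obtain ⟨I, hI⟩ : ∃ I : Type, #I = κ := ⟨κ.out, mk_out κ⟩
  have he : ∀ δ : W, ∃ e : W → I, InjOn e (Iio δ) := by
    intro δ
    have h1 : #(Iio δ) ≤ #I := by
      rw [hI]
      exact (mk_le_mk_of_subset Iio_subset_Iic_self).trans (hW.card_Iic_le δ)
    obtain ⟨f⟩ := h1
    have : Nonempty I := by
      rw [← mk_ne_zero_iff, hI]
      exact (aleph0_pos.trans_le hW.aleph0_le).ne'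
    refine ⟨fun x => if hx : x < δ then f ⟨x, hx⟩ else Classical.arbitrary _, ?_⟩
    intro x hx y hy hxy
    simp only [mem_Iio] at hx hy
    simp only [hx, hy, dif_pos] at hxy
    exact congrArg Subtype.val (f.injective hxy)
  choose e he using he
  have h1 : ∀ x, ∃ i, IsStat {δ ∈ S | x < δ ∧ e δ x = i} := by
    intro x
    refine (hS.inter_closurePoints hW id x).exists_of_subset_iUnion hW hI.le _ ?_
    rintro δ ⟨hδ, hx, -⟩
    exact mem_iUnion.2 ⟨e δ x, hδ, hx, rfl⟩
  choose i hi using h1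
  -- One value `k` serves κ⁺ many columns `x`. As `e δ` is injective below `δ`, at most one `x < δ`
  -- has `e δ x = k`, so the corresponding stationary sets are disjoint and `δ` determines its
  -- column.
  obtain ⟨k, hk⟩ : ∃ k, ∀ b, ∃ x, b ≤ x ∧ i x = k := by
    by_contra hcon
    push Not at hcon
    choose b hb using hcon
    obtain ⟨c, hc⟩ := hW.exists_gt_range b hI.le
    exact hb (i c) c (hc _).le rfl
  have hX : #W ≤ #{x | i x = k} := by
    refine hW.card_le.trans (Order.succ_le_of_lt ?_)
    by_contra hle
    obtain ⟨b, hb⟩ := hW.exists_gt _ (not_lt.1 hle)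
    obtain ⟨x, hx, hxk⟩ := hk b
    exact (hb x hxk).not_ge hx
  obtain ⟨g⟩ := hX
  refine ⟨fun δ => if hδ : ∃ γ, (g γ : W) < δ ∧ e δ (g γ) = k then hδ.choose else w₀,
    fun γ => (hi (g γ)).mono ?_⟩
  rintro δ ⟨hδ, hlt, heq⟩
  rw [(g γ).2] at heq
  have hex : ∃ γ, (g γ : W) < δ ∧ e δ (g γ) = k := ⟨γ, hlt, heq⟩
  refine ⟨hδ, ?_⟩
  simp only [dif_pos hex]
  have := he δ hex.choose_spec.1 hlt (hex.choose_spec.2.trans heq.symm)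
  exact g.injective (Subtype.ext this)

end IsStat

/-- Points of uncountable cofinality: countable sets below `δ` are bounded below `δ`. -/
def UncountableCof {W : Type} [LinearOrder W] (δ : W) : Prop :=
  ∀ s : Set W, s.Countable → (∀ x ∈ s, x < δ) → ∃ b < δ, ∀ x ∈ s, x < b

/-- The supremum of a strictly increasing sequence indexed by `V` is such a point, because countable
subsets of `V` are bounded; building the sequence closed under a majorant of `F` makes it a closure
point. -/
theorem isStat_uncountableCof {κ : Cardinal.{0}} {W V : Type} [LinearOrder W] [LinearOrder V]
    (hW : IsSuccCardOrder κ W) (hV : IsSuccCardOrder ℵ₀ V) (hVκ : #V ≤ κ) :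
    IsStat {δ : W | UncountableCof δ} := by
  classical
  intro F x₀
  have := hV.wf
  obtain ⟨F', hF'⟩ : ∃ F' : W → W, ∀ z, ∀ x ≤ z, F x < F' z := by
    choose F' hF' using fun z => hW.exists_gt_range (fun x : Iic z => F x) (hW.card_Iic_le z)
    exact ⟨F', fun z x hx => hF' z ⟨x, hx⟩⟩
  have hB : ∀ s : Set W, ∃ b, #s ≤ κ → x₀ < b ∧ ∀ x ∈ s, x < b ∧ F' x < b := by
    intro s
    by_cases hs : #s ≤ κ
    · obtain ⟨b, hb⟩ := hW.exists_gt s hs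
      obtain ⟨c, hc⟩ := hW.exists_gt_range (fun x : s => F' x) hs
      obtain ⟨d, hd⟩ := hW.exists_gt' x₀
      refine ⟨max b (max c d), fun _ => ⟨?_, fun x hx => ⟨?_, ?_⟩⟩⟩
      · simp [hd]
      · simp [hb x hx]
      · simp [hc ⟨x, hx⟩]
    · exact ⟨x₀, fun h => absurd h hs⟩
  choose B hB using hB
  let g : V → W := wellFounded_lt.fix fun i ih => B (range fun j : Iio i => ih j.1 j.2)
  have hg : ∀ i, g i = B (range fun j : Iio i => g j) := fun i => WellFounded.fix_eq _ _ _
  have hcard : ∀ i, #(range fun j : Iio i => g j) ≤ κ := fun i =>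
    mk_range_le.trans ((mk_set_le _).trans hVκ)
  have hg0 : ∀ i, x₀ < g i := fun i => by rw [hg]; exact (hB _ (hcard i)).1
  have hgm : ∀ i, ∀ j < i, g j < g i ∧ F' (g j) < g i := fun i j hj => by
    rw [hg i]; exact (hB _ (hcard i)).2 _ ⟨⟨j, hj⟩, rfl⟩
  obtain ⟨δ, h1, h2⟩ := hW.exists_isLeast_bound hVκ g
  obtain ⟨v⟩ := hV.nonempty
  refine ⟨δ, fun s hs hsδ => ?_, (hg0 v).trans (h1 v), fun x hx => ?_⟩
  · choose i hi using fun x : s => h2 x (hsδ x x.2)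
    obtain ⟨b, hb⟩ := hV.exists_gt_range i (le_aleph0_iff_set_countable.2 hs)
    exact ⟨g b, h1 b, fun x hx => (hi ⟨x, hx⟩).trans_lt (hgm _ _ (hb ⟨x, hx⟩)).1⟩
  · obtain ⟨i, hi⟩ := h2 x hx
    obtain ⟨k, hk⟩ := hV.exists_gt' i
    exact ((hF' _ x hi).trans (hgm _ _ hk).2).trans (h1 k)

/-! ### A colouring of the finite subsets of ω₁ -/

/-- A colouring of finite sets read off from a metric-like function `Δ` and finite-to-one
functions `e y`: for a pair `x < y` in `a` with `Δ x y` maximal one looks for the least `ξ` in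
`[x, y]` with `e y ξ ≤ Δ x y`, and colours by `f ξ`. -/
theorem exists_finset_colouring_of_maxDelta {V : Type} [LinearOrder V] (w₀ : V)
    (Δ : V → V → ℕ) (hΔ : ∀ x y, Δ x y = Δ y x) (e : V → V → ℕ) (f : V → V) :
    ∃ d : Finset V → V, ∀ (a : Finset V) (i j δ : V), i ∈ a → j ∈ a → i ≠ j →
      (∀ x ∈ a, ∀ y ∈ a, x < y → Δ i j ≤ Δ x y →
        IsLeast {ξ | x ≤ ξ ∧ ξ ≤ y ∧ e y ξ ≤ Δ x y} δ) → d a = f δ := by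
  classical
  let D : Finset V → ℕ := fun a => a.offDiag.sup fun p => Δ p.1 p.2
  let p : Finset V → V × V := fun a =>
    if h : ∃ p : V × V, p.1 ∈ a ∧ p.2 ∈ a ∧ p.1 < p.2 ∧ Δ p.1 p.2 = D a then h.choose else (w₀, w₀)
  refine ⟨fun a => f (if h : ∃ ξ, IsLeast {ξ | (p a).1 ≤ ξ ∧ ξ ≤ (p a).2 ∧
    e (p a).2 ξ ≤ Δ (p a).1 (p a).2} ξ then h.choose else w₀), fun a i j δ hi hj hij H => ?_⟩
  have hex : ∃ p : V × V, p.1 ∈ a ∧ p.2 ∈ a ∧ p.1 < p.2 ∧ Δ p.1 p.2 = D a := by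
    obtain ⟨q, hq, hqD⟩ := Finset.exists_mem_eq_sup a.offDiag
      ⟨(i, j), by simp [hi, hj, hij]⟩ fun p => Δ p.1 p.2
    obtain ⟨h1, h2, h3⟩ := Finset.mem_offDiag.1 hq
    rcases lt_or_gt_of_ne h3 with h | h
    · exact ⟨q, h1, h2, h, hqD.symm⟩
    · exact ⟨q.swap, h2, h1, h, (hΔ _ _).trans hqD.symm⟩
  have hp : p a = hex.choose := dif_pos hex
  obtain ⟨h1, h2, h3, h4⟩ := hex.choose_spec
  rw [← hp] at h1 h2 h3 h4
  -- Which maximal pair was chosen is unknown; the hypothesis covers every pair with value at least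
  -- `Δ i j`, hence every maximal one.
  have hle : Δ i j ≤ Δ (p a).1 (p a).2 := by
    rw [h4]
    exact Finset.le_sup (f := fun p : V × V => Δ p.1 p.2)
      (Finset.mem_offDiag.2 ⟨hi, hj, hij⟩ : (i, j) ∈ a.offDiag)
  have hl := H _ h1 _ h2 h3 hle
  have hex2 : ∃ ξ, IsLeast {ξ | (p a).1 ≤ ξ ∧ ξ ≤ (p a).2 ∧
    e (p a).2 ξ ≤ Δ (p a).1 (p a).2} ξ := ⟨δ, hl⟩
  simp only [dif_pos hex2]
  rw [hex2.choose_spec.unique hl]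

/-- Truncations of an injection of `V` into the Cantor space. -/
theorem exists_truncations {V : Type} [LinearOrder V] (hV : IsSuccCardOrder ℵ₀ V) :
    ∃ (Δ : V → V → ℕ) (res : ℕ → V → Finset ℕ), (∀ x y, Δ x y = Δ y x) ∧
      ∀ n x y, x ≠ y → (res n x = res n y ↔ n ≤ Δ x y) := by
  classical
  have h : #V ≤ #(ℕ → Bool) := by
    refine hV.card_le.trans (Order.succ_le_of_lt ?_)
    simpa using cantor ℵ₀
  obtain ⟨ρ⟩ := h
  refine ⟨fun x y => PiNat.firstDiff (ρ x) (ρ y),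
    fun n x => (Finset.range n).filter fun i => ρ x i = true,
    fun x y => PiNat.firstDiff_comm _ _, fun n x y hxy => ?_⟩
  have hne : ρ x ≠ ρ y := fun h => hxy (ρ.injective h)
  constructor
  · intro heq
    by_contra hlt
    have h1 := PiNat.apply_firstDiff_ne hne
    have h2 := Finset.ext_iff.1 heq (PiNat.firstDiff (ρ x) (ρ y))
    simp only [Finset.mem_filter, Finset.mem_range, not_le.1 hlt, true_and] at h2
    exact h1 (Bool.eq_iff_iff.2 h2)
  · intro hle
    ext k
    simp only [Finset.mem_filter, Finset.mem_range, and_congr_right_iff]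
    intro hk
    rw [PiNat.apply_eq_of_lt_firstDiff (hk.trans_le hle)]

/-- For finite sets `A k`, properties `Q` of `k` with parameters from a countable set, and almost
all `δ`: a property of some `k` with `A k` end-extending `R ⊆ δ` beyond `δ` is shared by sets
`A k` lying arbitrarily high, also below `δ`. -/
theorem exists_reflection {V T : Type} [LinearOrder V] (hV : IsSuccCardOrder ℵ₀ V) [Countable T]
    (A : V → Finset V) (Q : Finset V → T → V → Prop) :
    ∃ F : V → V, ∀ δ, IsClosurePoint F δ → ∀ (R : Finset V) (t : T), (∀ x ∈ R, x < δ) →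
      ∀ k, Q R t k → (∀ x ∈ A k, x ∉ R → δ ≤ x) →
      (∀ θ, θ < δ → ∀ θ', ∃ k, Q R t k ∧ ∀ x ∈ A k, x ∉ R → θ' < x) ∧
      ∀ θ < δ, ∃ k, Q R t k ∧ (∀ x ∈ A k, x ∉ R → θ < x) ∧ ∀ x ∈ A k, x < δ := by
  classical
  obtain ⟨w₀⟩ := hV.nonempty
  have h1 : ∀ (R : Finset V) (t : T), ∃ b, (∃ θ, ∀ k, Q R t k → ∃ x ∈ A k, x ∉ R ∧ x ≤ θ) →
      ∀ k, Q R t k → ∃ x ∈ A k, x ∉ R ∧ x ≤ b := by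
    intro R t
    by_cases h : ∃ θ, ∀ k, Q R t k → ∃ x ∈ A k, x ∉ R ∧ x ≤ θ
    · exact ⟨h.choose, fun _ => h.choose_spec⟩
    · exact ⟨w₀, fun h' => absurd h' h⟩
  choose b hb using h1
  have h2 : ∀ (R : Finset V) (t : T) (θ : V), ∃ c,
      (∃ k, Q R t k ∧ ∀ x ∈ A k, x ∉ R → θ < x) →
      ∃ k, Q R t k ∧ (∀ x ∈ A k, x ∉ R → θ < x) ∧ ∀ x ∈ A k, x < c := by
    intro R t θ
    by_cases h : ∃ k, Q R t k ∧ ∀ x ∈ A k, x ∉ R → θ < x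
    · obtain ⟨k, hk⟩ := h
      obtain ⟨c, hc⟩ := hV.exists_gt_range (fun x : A k => (x : V)) mk_le_aleph0
      exact ⟨c, fun _ => ⟨k, hk.1, hk.2, fun x hx => hc ⟨x, hx⟩⟩⟩
    · exact ⟨w₀, fun h' => absurd h' h⟩
  choose c hc using h2
  have hctb : ∀ z : V, Countable (Iic z) := fun z => mk_le_aleph0_iff.1 (hV.card_Iic_le z)
  let emb : ∀ z : V, Finset (Iic z) → Finset V := fun z R => R.map (Function.Embedding.subtype _)
  obtain ⟨F, hF⟩ := hV.exists_closure (fun z =>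
    (range fun p : Finset (Iic z) × T => b (emb z p.1) p.2) ∪
    range fun p : (Finset (Iic z) × T) × Iic z => c (emb z p.1.1) p.1.2 p.2) fun z => by
      have := hctb z
      exact le_aleph0_iff_set_countable.2 ((countable_range _).union (countable_range _))
  refine ⟨F, fun δ hδ R t hR k hk hkδ => ?_⟩
  have key : ∀ θ < δ, b R t < δ ∧ c R t θ < δ := by
    intro θ hθ
    obtain ⟨z, hz, hRz, hθz⟩ : ∃ z < δ, (∀ x ∈ R, x ≤ z) ∧ θ ≤ z := by
      refine ⟨(insert θ R).max' (by simp), ?_, fun x hx => Finset.le_max' _ _ (by simp [hx]),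
        Finset.le_max' _ _ (by simp)⟩
      rw [Finset.max'_lt_iff]
      simpa [hθ] using hR
    have hRe : emb z (R.subtype (· ∈ Iic z)) = R := by
      simp only [emb, Finset.subtype_map]
      exact Finset.filter_true_of_mem hRz
    constructor
    · refine hF δ hδ z hz _ (Or.inl ⟨(R.subtype (· ∈ Iic z), t), ?_⟩)
      simp only [hRe]
    · refine hF δ hδ z hz _ (Or.inr ⟨((R.subtype (· ∈ Iic z), t), ⟨θ, hθz⟩), ?_⟩)
      simp only [hRe]
  -- If no copy lay entirely above some height off `R`, then `b R t < δ` would already be such a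
  -- height, while `A k` off `R` lies above `δ`.
  have hunb : ∀ θ, θ < δ → ∀ θ', ∃ k, Q R t k ∧ ∀ x ∈ A k, x ∉ R → θ' < x := by
    intro θ hθ θ'
    by_contra hcon
    push Not at hcon
    obtain ⟨x, hx, hxR, hxb⟩ := hb R t ⟨θ', hcon⟩ k hk
    exact ((hxb.trans_lt (key θ hθ).1).trans_le (hkδ x hx hxR)).false
  refine ⟨hunb, fun θ hθ => ?_⟩
  obtain ⟨k', h1, h2, h3⟩ := hc R t θ (hunb θ hθ θ)
  exact ⟨k', h1, h2, fun x hx => (h3 x hx).trans (key θ hθ).2⟩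

/-- A colouring `d` of the finite subsets of `ω₁` that takes any given colour `ν` simultaneously
on all unions `a ∪ b` with `a` in `U i` and `b` in `U' j`, for suitable `i` and `j`, whenever all
members of `U k` and `U' k` contain `k`. -/
theorem exists_finset_colouring {V : Type} [LinearOrder V] (hV : IsSuccCardOrder ℵ₀ V) :
    ∃ d : Finset V → V, ∀ K : Set V, (∀ b, ∃ k ∈ K, b ≤ k) → ∀ (φ : V → V)
      (U U' : V → Finset (Finset V)), (∀ k ∈ K, ∀ a ∈ U k, k ∈ a) →
      (∀ k ∈ K, ∀ a ∈ U' k, k ∈ a) → ∀ ν, ∃ i ∈ K, ∃ j ∈ K, φ i < j ∧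
        ∀ a ∈ U i, ∀ b ∈ U' j, d (a ∪ b) = ν := by
  classical
  obtain ⟨w₀⟩ := hV.nonempty
  obtain ⟨f, hf⟩ := (hV.isStat_univ).exists_partition hV
  obtain ⟨Δ, res, hΔ, hres⟩ := exists_truncations hV
  have he : ∀ y : V, ∃ e : V → ℕ, InjOn e (Iic y) := fun y =>
    (countable_iff_exists_injOn.1 (le_aleph0_iff_set_countable.1 (hV.card_Iic_le y)))
  choose e he using he
  obtain ⟨d, hd⟩ := exists_finset_colouring_of_maxDelta w₀ Δ hΔ e f
  refine ⟨d, fun K hK φ U U' hU hU' ν => ?_⟩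
  let A : V → Finset V := fun k => insert k ((U k).biUnion id ∪ (U' k).biUnion id)
  have hkA : ∀ k, k ∈ A k := fun k => Finset.mem_insert_self _ _
  have hUA : ∀ k, ∀ a ∈ U k, a ⊆ A k := fun k a ha x hx =>
    Finset.mem_insert_of_mem (Finset.mem_union_left _ (Finset.mem_biUnion.2 ⟨a, ha, hx⟩))
  have hUA' : ∀ k, ∀ a ∈ U' k, a ⊆ A k := fun k a ha x hx =>
    Finset.mem_insert_of_mem (Finset.mem_union_right _ (Finset.mem_biUnion.2 ⟨a, ha, hx⟩))
  -- The parameter `t` records a strict bound for `Δ` inside `A k`, a truncation level, the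
  -- truncation of `k`, and the truncations of the points off the root `R`.
  let Q : Finset V → ℕ × ℕ × Finset ℕ × Finset (Finset ℕ) → V → Prop := fun R t k =>
    k ∈ K ∧ R ⊆ A k ∧ (∀ x ∈ A k, ∀ y ∈ A k, x ≠ y → Δ x y < t.1) ∧ res t.2.1 k = t.2.2.1 ∧
      (A k \ R).image (res t.2.1) = t.2.2.2
  obtain ⟨F₁, hF₁⟩ := exists_reflection hV A Q
  obtain ⟨F, hF⟩ := hV.exists_closure_family (ι := Bool) mk_le_aleph0
    (fun b => bif b then F₁ else φ)
  obtain ⟨δ, ⟨-, hδν⟩, hw, hδ⟩ := hf ν F w₀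
  have hφ : IsClosurePoint φ δ := hF δ hδ false
  have hrefl := hF₁ δ (hF δ hδ true)
  obtain ⟨j, hjK, hj⟩ := hK δ
  let R := (A j).filter (· < δ)
  have hRδ : ∀ x ∈ R, x < δ := fun x hx => (Finset.mem_filter.1 hx).2
  have hjR : ∀ x ∈ A j, x ∉ R → δ ≤ x := fun x hx hxR => by
    by_contra h
    exact hxR (Finset.mem_filter.2 ⟨hx, not_le.1 h⟩)
  let n₀ := ((A j).product (A j)).sup (fun p => Δ p.1 p.2) + 1
  have hn₀ : ∀ x ∈ A j, ∀ y ∈ A j, x ≠ y → Δ x y < n₀ := fun x hx y hy _ =>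
    Nat.lt_succ_of_le (Finset.le_sup (f := fun p : V × V => Δ p.1 p.2)
      (Finset.mk_mem_product hx hy))
  -- Agreement to level `N` exceeds every agreement inside one block and admits `δ` as a candidate
  -- for each `e y`.
  let N := max n₀ ((A j).sup fun y => e y δ)
  have hN : ∀ y ∈ A j, e y δ ≤ N := fun y hy =>
    (Finset.le_sup (f := fun y => e y δ) hy).trans (le_max_right _ _)
  have hQj : Q R (n₀, N, res N j, (A j \ R).image (res N)) j :=
    ⟨hjK, Finset.filter_subset _ _, hn₀, rfl, rfl⟩
  obtain ⟨b, hb⟩ := hV.exists_gt_range (fun x : A j => (x : V)) mk_le_aleph0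
  -- The intermediate copy agrees with `j` to level `N`, but off `R` it lies above all of `A j`, so
  -- some level `M` separates it from `A j`. A copy `i` of `j'` at level `M` inherits both: `Δ i j ≥
  -- N`, and cross pairs off `R` have `Δ ≤ M`.
  obtain ⟨j', hQj', hj'⟩ := (hrefl R _ hRδ j hQj hjR).1 w₀ hw (max b δ)
  obtain ⟨hj'K, hRj', hn₀', hNj', -⟩ := hQj'
  let M := max N (((A j').product (A j)).sup (fun p => Δ p.1 p.2) + 1)
  have hM : ∀ x ∈ A j', x ∉ R → ∀ y ∈ A j, res M x ≠ res M y := by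
    intro x hx hxR y hy heq
    have hne : x ≠ y := by
      rintro rfl
      exact ((hj' x hx hxR).trans (hb ⟨x, hy⟩)).not_ge (le_max_left _ _)
    have h1 := (hres M x y hne).1 heq
    have h2 : Δ x y < M := (Nat.lt_succ_of_le (Finset.le_sup (f := fun p : V × V => Δ p.1 p.2)
      (Finset.mk_mem_product hx hy))).trans_le (le_max_right _ _)
    omega
  -- Only finitely many `ξ < δ` compete with `δ`, each `e y` being injective; the new points of `A
  -- i` are placed above all of them.
  obtain ⟨θ, hθδ, hθ⟩ : ∃ θ < δ, ∀ y ∈ A j, δ ≤ y → ∀ ξ < δ, e y ξ ≤ M → ξ ≤ θ := by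
    have hfin : (⋃ y ∈ (A j : Set V), {ξ | ξ < δ ∧ δ ≤ y ∧ e y ξ ≤ M}).Finite := by
      refine (A j).finite_toSet.biUnion fun y _ => ?_
      refine Finite.of_finite_image ((finite_Iic M).subset ?_) (f := e y) ?_
      · rintro _ ⟨ξ, ⟨-, -, h⟩, rfl⟩
        exact h
      · exact (he y).mono fun ξ hξ => (hξ.1.trans_le hξ.2.1).le
    refine ⟨(insert w₀ hfin.toFinset).max' (by simp), ?_, fun y hy hδy ξ hξ hle =>
      Finset.le_max' _ _ ?_⟩
    · rw [Finset.max'_lt_iff]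
      intro x hx
      rcases Finset.mem_insert.1 hx with rfl | hx
      · exact hw
      · simp only [Finite.mem_toFinset, mem_iUnion] at hx
        obtain ⟨y, -, hx, -⟩ := hx
        exact hx
    · refine Finset.mem_insert_of_mem ?_
      simp only [Finite.mem_toFinset, mem_iUnion]
      exact ⟨y, hy, hξ, hδy, hle⟩
  have hQj'' : Q R (n₀, M, res M j', (A j' \ R).image (res M)) j' :=
    ⟨hj'K, hRj', hn₀', rfl, rfl⟩
  obtain ⟨i, ⟨hiK, hRi, hn₀i, hMi, hPi⟩, hiθ, hiδ⟩ := (hrefl R _ hRδ j' hQj''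
    fun x hx hxR => ((le_max_right _ _).trans_lt (hj' x hx hxR)).le).2 θ hθδ
  have hij : i < j := (hiδ i (hkA i)).trans_le hj
  have hres_le : ∀ m n x y, m ≤ n → res n x = res n y → res m x = res m y := by
    intro m n x y hmn heq
    by_cases hxy : x = y
    · rw [hxy]
    · exact (hres m x y hxy).2 (hmn.trans ((hres n x y hxy).1 heq))
  have hNij : N ≤ Δ i j := (hres N i j hij.ne).1 <|
    (hres_le N M i j' (le_max_left _ _) hMi).trans hNj'
  refine ⟨i, hiK, j, hjK, (hφ i (hiδ i (hkA i))).trans_le hj, fun a ha b hb => ?_⟩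
  have hsub : ∀ x ∈ a ∪ b, x ∈ A i ∨ x ∈ A j := fun x hx =>
    (Finset.mem_union.1 hx).imp (fun h => hUA i a ha h) fun h => hUA' j b hb h
  rw [← hδν]
  refine hd (a ∪ b) i j δ (Finset.mem_union_left _ (hU i hiK a ha))
    (Finset.mem_union_right _ (hU' j hjK b hb)) hij.ne fun x hx y hy hxy hle => ?_
  -- A pair agreeing this long cannot lie in one block, so it joins a point of `A i` to a point of
  -- `A j`, both off the root.
  have hnΔ : n₀ ≤ Δ x y := ((le_max_left _ _).trans hNij).trans hle
  have hnoti : ¬ (x ∈ A i ∧ y ∈ A i) := fun h => (hn₀i x h.1 y h.2 hxy.ne).not_ge hnΔ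
  have hnotj : ¬ (x ∈ A j ∧ y ∈ A j) := fun h => (hn₀ x h.1 y h.2 hxy.ne).not_ge hnΔ
  have hRj : ∀ z ∈ R, z ∈ A j := fun z hz => (Finset.mem_filter.1 hz).1
  have hxi : x ∈ A i ∧ x ∉ R ∧ y ∈ A j ∧ y ∉ R := by
    rcases hsub x hx with h1 | h1 <;> rcases hsub y hy with h2 | h2
    · exact absurd ⟨h1, h2⟩ hnoti
    · exact ⟨h1, fun h => hnotj ⟨hRj x h, h2⟩, h2, fun h => hnoti ⟨h1, hRi h⟩⟩
    · have h3 : x ∉ R := fun h => hnoti ⟨hRi h, h2⟩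
      exact absurd ((hiδ y h2).trans_le (hjR x h1 h3)) hxy.not_gt
    · exact absurd ⟨h1, h2⟩ hnotj
  obtain ⟨hxA, hxR, hyA, hyR⟩ := hxi
  have hδy := hjR y hyA hyR
  have hΔM : Δ x y ≤ M := by
    by_contra hlt
    have h1 : res M x ∈ (A j' \ R).image (res M) :=
      hPi.le (Finset.mem_image_of_mem _ (Finset.mem_sdiff.2 ⟨hxA, hxR⟩))
    obtain ⟨x', hx', hxx'⟩ := Finset.mem_image.1 h1
    rw [Finset.mem_sdiff] at hx'
    exact hM x' hx'.1 hx'.2 y hyA (hxx'.trans ((hres M x y hxy.ne).2 (not_le.1 hlt).le))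
  refine ⟨⟨(hiδ x hxA).le, hδy, (hN y hyA).trans (hNij.trans hle)⟩, ?_⟩
  rintro ξ ⟨hxξ, -, heξ⟩
  by_contra hξ
  exact ((hθ y hyA hδy ξ (not_le.1 hξ) (heξ.trans hΔM)).trans_lt (hiθ x hxA hxR)).not_ge hxξ

/-! ### Minimal walks -/

/-- The data for minimal walks on `W` along sequences of length `V`: for `ζ < ξ`, `r ζ ξ` is the
least index `i` with `ζ ≤ f ξ i`. -/
structure WalkData (V W : Type) [LinearOrder V] [LinearOrder W] where
  f : W → V → W
  r : W → W → V
  f_lt : ∀ {ζ ξ} i, ζ < ξ → f ξ i < ξ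
  le_f_r : ∀ {ζ ξ}, ζ < ξ → ζ ≤ f ξ (r ζ ξ)
  f_lt_of_lt_r : ∀ {ζ ξ i}, ζ < ξ → i < r ζ ξ → f ξ i < ζ

/-- Any enumeration of the predecessors of `ξ` along `V`, repetitions allowed, will do; no club
structure is needed. -/
theorem exists_walkData {κ : Cardinal.{0}} {V W : Type} [LinearOrder V] [LinearOrder W]
    [WellFoundedLT V] (hW : IsSuccCardOrder κ W) (hV : κ ≤ #V) : Nonempty (WalkData V W) := by
  classical
  have h1 : ∀ ξ : W, ∃ g : V → W, ∀ ζ < ξ, (∀ i, g i < ξ) ∧ ∃ i, g i = ζ := by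
    intro ξ
    by_cases hξ : Nonempty (Iio ξ)
    · have h2 : #(Iio ξ) ≤ #V :=
        ((mk_le_mk_of_subset Iio_subset_Iic_self).trans (hW.card_Iic_le ξ)).trans hV
      obtain ⟨e⟩ := h2
      refine ⟨fun i => (Function.invFun e i).1, fun ζ hζ => ⟨fun i => (Function.invFun e i).2, ?_⟩⟩
      exact ⟨e ⟨ζ, hζ⟩, congrArg Subtype.val (Function.leftInverse_invFun e.injective ⟨ζ, hζ⟩)⟩
    · exact ⟨fun _ => ξ, fun ζ hζ => absurd ⟨⟨ζ, hζ⟩⟩ hξ⟩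
  choose f hf using h1
  have hr : ∀ ζ ξ : W, ∃ k : V, ζ < ξ → ζ ≤ f ξ k ∧ ∀ i < k, f ξ i < ζ := by
    intro ζ ξ
    by_cases h : ζ < ξ
    · obtain ⟨i, hi⟩ := (hf ξ ζ h).2
      obtain ⟨k, hk, hmin⟩ := exists_minimal_of_wellFoundedLT (fun i => ζ ≤ f ξ i) ⟨i, hi.ge⟩
      exact ⟨k, fun _ => ⟨hk, fun i hi => not_le.1 fun hle => (hmin hle hi.le).not_gt hi⟩⟩
    · have hVne : Nonempty V := by
        rw [← mk_ne_zero_iff]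
        exact ((aleph0_pos.trans_le hW.aleph0_le).trans_le hV).ne'
      exact ⟨hVne.some, fun h' => absurd h' h⟩
  choose r hr using hr
  exact ⟨⟨f, r, fun i h => (hf _ _ h).1 i, fun h => (hr _ _ h).1, fun h => (hr _ _ h).2 _⟩⟩

namespace WalkData

variable {V W : Type} [LinearOrder V] [LinearOrder W] (D : WalkData V W)

theorem r_mono {ζ ζ' ξ : W} (h : ζ ≤ ζ') (h' : ζ' < ξ) : D.r ζ ξ ≤ D.r ζ' ξ := by
  by_contra hlt
  exact (D.f_lt_of_lt_r (h.trans_lt h') (not_le.1 hlt)).not_ge (h.trans (D.le_f_r h'))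

theorem r_eq {ζ ξ : W} {i : V} (h : ζ < ξ) (h1 : ζ ≤ D.f ξ i) (h2 : ∀ k < i, D.f ξ k < ζ) :
    D.r ζ ξ = i := by
  refine le_antisymm ?_ ?_
  · by_contra hlt
    exact (D.f_lt_of_lt_r h (not_le.1 hlt)).not_ge h1
  · by_contra hlt
    exact (h2 _ (not_le.1 hlt)).not_ge (D.le_f_r h)

/-- Below a point `δ` of uncountable cofinality the indices `r ζ δ` are unbounded. -/
theorem exists_forall_lt_r (hV : IsSuccCardOrder ℵ₀ V) {δ : W} (hδ : UncountableCof δ)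
    (i : V) : ∃ b < δ, ∀ ζ, b < ζ → ζ < δ → i < D.r ζ δ := by
  by_cases hne : ∃ x, x < δ
  · obtain ⟨x₀, hx⟩ := hne
    have hc : (Iic i).Countable := le_aleph0_iff_set_countable.1 (hV.card_Iic_le i)
    obtain ⟨b, hb, hbl⟩ := hδ _ (hc.image (D.f δ)) (by
      rintro _ ⟨k, -, rfl⟩
      exact D.f_lt k hx)
    refine ⟨b, hb, fun ζ hζ hζδ => ?_⟩
    by_contra hle
    exact ((hbl _ ⟨_, not_lt.1 hle, rfl⟩).trans hζ).not_ge (D.le_f_r hζδ)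
  · obtain ⟨b, hb, -⟩ := hδ ∅ countable_empty (by simp)
    exact absurd ⟨b, hb⟩ hne

variable [WellFoundedLT W]

/-- The points strictly above `ζ` on the minimal walk from `ξ` down to `ζ`. -/
noncomputable def walk {V W : Type} [LinearOrder V] [LinearOrder W] [WellFoundedLT W]
    (D : WalkData V W) (ζ ξ : W) : List W :=
  if _h : ζ < ξ then ξ :: D.walk ζ (D.f ξ (D.r ζ ξ)) else []
termination_by (wellFounded_lt (α := W)).wrap ξ
decreasing_by exact D.f_lt _ ‹_›

/-- The set of the indices used along the walk from `ξ` down to `ζ`. -/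
noncomputable def trace (ζ ξ : W) : Finset V := ((D.walk ζ ξ).map (D.r ζ)).toFinset

theorem walk_of_lt {ζ ξ : W} (h : ζ < ξ) :
    D.walk ζ ξ = ξ :: D.walk ζ (D.f ξ (D.r ζ ξ)) := by
  rw [walk, dif_pos h]

theorem walk_self (ζ : W) : D.walk ζ ζ = [] := by
  rw [walk, dif_neg (lt_irrefl ζ)]

theorem r_mem_trace {ζ ξ : W} (h : ζ < ξ) : D.r ζ ξ ∈ D.trace ζ ξ := by
  simp [trace, D.walk_of_lt h]

/-- Walks from `ξ` to points of the interval `(l, δ]` pass through `δ`. -/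
def Passes (δ ξ l : W) : Prop :=
  ∀ ζ, l < ζ → ζ ≤ δ → D.walk ζ ξ = D.walk δ ξ ++ D.walk ζ δ ∧
    ∀ η ∈ D.walk δ ξ, D.r ζ η = D.r δ η

variable {D}

theorem Passes.mono {δ ξ l l' : W} (h : D.Passes δ ξ l) (hl : l ≤ l') : D.Passes δ ξ l' :=
  fun ζ hζ => h ζ (hl.trans_lt hζ)

theorem Passes.trace_eq {δ ξ l ζ : W} (h : D.Passes δ ξ l) (hζ : l < ζ) (hδ : ζ ≤ δ) :
    D.trace ζ ξ = D.trace δ ξ ∪ D.trace ζ δ := by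
  obtain ⟨h1, h2⟩ := h ζ hζ hδ
  rw [trace, h1, List.map_append, List.toFinset_append, trace, trace, List.map_congr_left h2]

/-- The countably many values of `f ξ` before index `r δ ξ` lie below `δ`, hence are bounded below
`δ`. Above that bound the first step is the same as towards `δ`; induction on `ξ` handles the rest.
-/
theorem exists_passes (hV : IsSuccCardOrder ℵ₀ V) {δ x₀ : W} (hx : x₀ < δ)
    (hδ : UncountableCof δ) (ξ : W) (hξ : δ ≤ ξ) : ∃ l < δ, D.Passes δ ξ l := by
  induction ξ using WellFoundedLT.induction with
  | ind ξ ih =>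
    rcases hξ.eq_or_lt with rfl | hlt
    · refine ⟨x₀, hx, fun ζ _ _ => ?_⟩
      simp [D.walk_self]
    · obtain ⟨l, hl, hlp⟩ := ih _ (D.f_lt (D.r δ ξ) hlt) (D.le_f_r hlt)
      have hc : (Iio (D.r δ ξ)).Countable := le_aleph0_iff_set_countable.1
        ((mk_le_mk_of_subset Iio_subset_Iic_self).trans (hV.card_Iic_le _))
      obtain ⟨b, hb, hbl⟩ := hδ _ (hc.image (D.f ξ)) (by
        rintro _ ⟨i, hi, rfl⟩
        exact D.f_lt_of_lt_r hlt hi)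
      refine ⟨max l b, max_lt hl hb, fun ζ hζ hζδ => ?_⟩
      have hr : D.r ζ ξ = D.r δ ξ := D.r_eq (hζδ.trans_lt hlt) (hζδ.trans (D.le_f_r hlt))
        fun k hk => (hbl _ ⟨k, hk, rfl⟩).trans ((le_max_right _ _).trans_lt hζ)
      obtain ⟨h1, h2⟩ := hlp ζ ((le_max_left _ _).trans_lt hζ) hζδ
      rw [D.walk_of_lt (hζδ.trans_lt hlt), D.walk_of_lt hlt, hr, h1]
      refine ⟨rfl, fun η hη => ?_⟩
      rcases List.mem_cons.1 hη with rfl | hη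
      · exact hr
      · exact h2 η hη

theorem exists_passes_finset (hV : IsSuccCardOrder ℵ₀ V) {δ x₀ : W} (hx : x₀ < δ)
    (hδ : UncountableCof δ) (s : Finset W) (hs : ∀ ξ ∈ s, δ ≤ ξ) :
    ∃ l < δ, ∀ ξ ∈ s, D.Passes δ ξ l := by
  classical
  induction s using Finset.induction_on with
  | empty => exact ⟨x₀, hx, by simp⟩
  | insert ξ s _ ih =>
    obtain ⟨l, hl, h1⟩ := ih fun ξ hξ => hs ξ (Finset.mem_insert_of_mem hξ)
    obtain ⟨l', hl', h2⟩ := exists_passes (D := D) hV hx hδ ξ (hs ξ (Finset.mem_insert_self _ _))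
    refine ⟨max l l', max_lt hl hl', fun η hη => ?_⟩
    rcases Finset.mem_insert.1 hη with rfl | hη
    · exact h2.mono (le_max_right _ _)
    · exact (h1 η hη).mono (le_max_left _ _)

end WalkData

/-! ### The strong colouring of pairs -/

section

variable {V W : Type} [LinearOrder V] [LinearOrder W]

/-- Members of a disjoint family of finite sets with arbitrarily large index lie arbitrarily
high. -/
theorem IsSuccCardOrder.exists_index_forall_lt {κ : Cardinal.{0}} (hW : IsSuccCardOrder κ W)
    {u : W → Finset W} (hu : ∀ α β, α < β → Disjoint (u α) (u β)) (x : W) :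
    ∃ β, x < β ∧ ∀ ξ ∈ u β, x < ξ := by
  classical
  have h1 : ∀ y : W, ∃ α, ∀ β, y ∈ u β → β ≤ α := by
    intro y
    by_cases h : ∃ α, y ∈ u α
    · obtain ⟨α, hα⟩ := h
      refine ⟨α, fun β hβ => ?_⟩
      by_contra hlt
      exact (Finset.disjoint_left.1 (hu α β (not_le.1 hlt)) hα) hβ
    · exact ⟨y, fun β hβ => absurd ⟨β, hβ⟩ h⟩
  choose α hα using h1
  obtain ⟨b, hb⟩ := hW.exists_gt_range (fun y : Iic x => α y) (hW.card_Iic_le x)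
  obtain ⟨c, hc⟩ := hW.exists_gt' x
  refine ⟨max b c, by simp [hc], fun ξ hξ => ?_⟩
  by_contra hle
  exact ((hα ξ _ hξ).trans_lt (hb ⟨ξ, not_lt.1 hle⟩)).not_ge (le_max_left _ _)

/-- If `T` is stationary then, for many `δ ∈ T`, uncountably many indices `r δ₁ δ` with `δ₁ < δ`
are also of the form `r δ δ₀` with `δ < δ₀`. Here `δ₁` ranges over `T` and over closure points
of a given function, and `δ₀` over `T`. -/
theorem exists_two_sided_index {κ : Cardinal.{0}} (D : WalkData V W) [WellFoundedLT W]
    (hW : IsSuccCardOrder κ W) (hV : IsSuccCardOrder ℵ₀ V) (hVκ : #V ≤ κ) {T : Set W}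
    (hT : IsStat T) (hTc : ∀ δ ∈ T, UncountableCof δ) (G : W → W) (x₀ : W) :
    ∃ δ ∈ T, x₀ < δ ∧ ∀ b < δ, ∃ δ₁ ∈ T, b < δ₁ ∧ δ₁ < δ ∧ IsClosurePoint G δ₁ ∧
      ∃ δ₀ ∈ T, δ < δ₀ ∧ D.r δ δ₀ = D.r δ₁ δ := by
  classical
  let Q : V → Set W := fun j => {ε ∈ T | ∃ δ₀ ∈ T, ε < δ₀ ∧ D.r ε δ₀ = j}
  -- The index of the step from `δ₀` is constant on an interval `(l, ε]`. Fixing `l` for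
  -- stationarily many `ε` spreads the property to every point above `l`.
  have h1 : ∀ j, ∃ l, IsStat (Q j) → ∀ ζ, l < ζ → ∃ δ₀ ∈ T, ζ < δ₀ ∧ D.r ζ δ₀ = j := by
    intro j
    by_cases hj : IsStat (Q j)
    · obtain ⟨l, hl⟩ := (hj.inter_closurePoints hW id x₀).fodor hW
        (fun ε l => ∃ δ₀ ∈ T, ε < δ₀ ∧ ∀ ζ, l < ζ → ζ ≤ ε → D.r ζ δ₀ = j) (by
          rintro ε ⟨⟨hεT, δ₀, hδ₀, hlt, hr⟩, hx, -⟩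
          obtain ⟨l, hl, hp⟩ := WalkData.exists_passes (D := D) hV hx (hTc ε hεT) δ₀ hlt.le
          refine ⟨l, hl, δ₀, hδ₀, hlt, fun ζ hζ hζε => ?_⟩
          rw [← hr]
          exact (hp ζ hζ hζε).2 δ₀ (by rw [D.walk_of_lt hlt]; exact List.mem_cons_self))
      refine ⟨l, fun _ ζ hζ => ?_⟩
      obtain ⟨ε, ⟨-, δ₀, hδ₀, hlt, hr⟩, hζε, -⟩ := hl id ζ
      exact ⟨δ₀, hδ₀, hζε.trans hlt, hr ζ hζ hζε.le⟩
    · exact ⟨x₀, fun h => absurd h hj⟩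
  choose l hl using h1
  -- A nonstationary `Q j` misses all large closure points of some function; handling all `j` at
  -- once makes membership of a suitable point in `Q j` imply stationarity.
  have h2 : ∀ j, ∃ (F : W → W) (x : W), ∀ ε ∈ Q j, x < ε → IsClosurePoint F ε → IsStat (Q j) := by
    intro j
    by_cases hj : IsStat (Q j)
    · exact ⟨id, x₀, fun _ _ _ _ => hj⟩
    · simp only [IsStat] at hj
      push Not at hj
      obtain ⟨F, x, hF⟩ := hj
      exact ⟨F, x, fun ε hε hx hc => absurd hc (hF ε hε hx)⟩
  choose F x hF using h2
  obtain ⟨H, hH⟩ := hW.exists_closure_family hVκ F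
  obtain ⟨H', hH'⟩ := hW.exists_closure_family (ι := Bool)
    (mk_le_aleph0.trans hW.aleph0_le) (fun b => bif b then H else G)
  obtain ⟨b₁, hb₁⟩ := hW.exists_gt_range l hVκ
  obtain ⟨b₂, hb₂⟩ := hW.exists_gt_range x hVκ
  have hT' := hT.inter_closurePoints hW H' b₂
  choose nxt hnxt using fun z => hT' id z
  obtain ⟨δ, hδT, hδ, hδc⟩ := hT nxt (max x₀ b₁)
  refine ⟨δ, hδT, (le_max_left _ _).trans_lt hδ, fun b hb => ?_⟩
  obtain ⟨⟨h3, h4, h5⟩, h6, -⟩ := hnxt b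
  have h7 := hδc b hb
  -- Here `δ` itself is the witness above `nxt b`. Stationarity then makes the same index recur
  -- above `δ`.
  have hst : IsStat (Q (D.r (nxt b) δ)) :=
    hF _ (nxt b) ⟨h3, δ, hδT, h7, rfl⟩ ((hb₂ _).trans h4) (hH _ (hH' _ h5 true) _)
  exact ⟨nxt b, h3, h6, h7, hH' _ h5 false,
    hl _ hst δ ((hb₁ _).trans ((le_max_right _ _).trans_lt hδ))⟩

/-- The first point `η` on the walk from `ξ` to `ζ` whose index exceeds `ν`. -/
noncomputable def WalkData.pick [WellFoundedLT W] (D : WalkData V W) (ν : V) (ζ ξ : W) : W :=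
  ((D.walk ζ ξ).find? fun η => decide (ν < D.r ζ η)).getD ξ

theorem WalkData.pick_eq [WellFoundedLT W] (D : WalkData V W) {ν : V} {ζ ξ η : W} {l₁ l₂ : List W}
    (h : D.walk ζ ξ = l₁ ++ η :: l₂) (h1 : ∀ η' ∈ l₁, D.r ζ η' ≤ ν) (h2 : ν < D.r ζ η) :
    D.pick ν ζ ξ = η := by
  have h3 : l₁.find? (fun η => decide (ν < D.r ζ η)) = none := by
    rw [List.find?_eq_none]
    intro y hy
    simpa using h1 y hy
  rw [pick, h, List.find?_append, h3, List.find?_cons_of_pos (by simpa using h2)]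
  rfl

/-- The colouring principle, for colourings of the pairs of `ω₂`. -/
theorem exists_strong_colouring {κ : Cardinal.{0}} (hW : IsSuccCardOrder κ W)
    (hV : IsSuccCardOrder ℵ₀ V) (hVκ : #V = κ) :
    ∃ c : W → W → W, (∀ ζ ξ, c ζ ξ = c ξ ζ) ∧ ∀ u : W → Finset W,
      (∀ α β, α < β → Disjoint (u α) (u β)) → ∀ γ, ∃ α β, α < β ∧
        ∀ ζ ∈ u α, ∀ ξ ∈ u β, c ζ ξ = γ := by
  classical
  have := hW.wf
  have := hV.wf
  obtain ⟨D⟩ := exists_walkData (V := V) hW hVκ.ge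
  obtain ⟨d, hd⟩ := exists_finset_colouring hV
  obtain ⟨h, hh⟩ := (isStat_uncountableCof hW hV hVκ.le).exists_partition hW
  refine ⟨fun ζ ξ => h (D.pick (d (D.trace (min ζ ξ) (max ζ ξ))) (min ζ ξ) (max ζ ξ)),
    fun ζ ξ => by simp only [min_comm ζ ξ, max_comm ζ ξ], fun u hu γ => ?_⟩
  obtain ⟨w₀⟩ := hW.nonempty
  choose B hB hBu using hW.exists_index_forall_lt hu
  -- a stationary set on which the walks from `u (B δ)` pass through `δ` in a uniform way
  obtain ⟨l, hl⟩ := ((hh γ).inter_closurePoints hW id w₀).fodor hW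
    (fun δ l => ∀ ξ ∈ u (B δ), D.Passes δ ξ l) (by
      rintro δ ⟨⟨hδ, -⟩, hw, -⟩
      exact WalkData.exists_passes_finset hV hw hδ _ fun ξ hξ => (hBu δ ξ hξ).le)
  -- This `ν` is the value later demanded of `d`: the stopping rule must skip every point of the
  -- walk above `δ`.
  obtain ⟨ν, hT⟩ := hl.exists_of_subset_iUnion hW hVκ.le
    (fun ν => {δ | (UncountableCof δ ∧ h δ = γ) ∧ (∀ ξ ∈ u (B δ), D.Passes δ ξ l) ∧
      ∀ ξ ∈ u (B δ), ∀ η ∈ D.walk δ ξ, D.r δ η ≤ ν}) (by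
      rintro δ ⟨⟨hδ, -⟩, hp⟩
      obtain ⟨ν, hν⟩ := hV.exists_gt_range
        (fun i : ((u (B δ)).biUnion (D.trace δ)) => (i : V)) mk_le_aleph0
      refine mem_iUnion.2 ⟨ν, hδ, hp, fun ξ hξ η hη => (hν ⟨D.r δ η, ?_⟩).le⟩
      refine Finset.mem_biUnion.2 ⟨ξ, hξ, ?_⟩
      rw [WalkData.trace, List.mem_toFinset]
      exact List.mem_map_of_mem hη)
  set T := {δ | (UncountableCof δ ∧ h δ = γ) ∧ (∀ ξ ∈ u (B δ), D.Passes δ ξ l) ∧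
      ∀ ξ ∈ u (B δ), ∀ η ∈ D.walk δ ξ, D.r δ η ≤ ν}
  -- For `b` below a closure point `δ₁`, the whole set `u (B b)` lies between `b` and `δ₁`; for `b`
  -- close to `δ₁` all its points have the index of `δ₁` at `δ`.
  obtain ⟨G, hG⟩ := hW.exists_closure (fun z => insert (B z) (u (B z))) fun z => by
    refine le_trans ?_ hW.aleph0_le
    exact le_aleph0_iff_set_countable.2 ((u (B z)).countable_toSet.insert _)
  obtain ⟨δ, hδT, hlδ, hδ⟩ := exists_two_sided_index D hW hV hVκ.le hT (fun δ hδ => hδ.1.1) G l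
  have hδc := hδT.1.1
  let K : Set V := {j | ν < j ∧ ∃ δ₁ < δ, IsClosurePoint G δ₁ ∧ UncountableCof δ₁ ∧
    (∃ x, x < δ₁) ∧ D.r δ₁ δ = j ∧ ∃ δ₀ ∈ T, δ < δ₀ ∧ D.r δ δ₀ = j}
  have hK : ∀ b, ∃ k ∈ K, b ≤ k := by
    intro b
    obtain ⟨b', hb', hr⟩ := WalkData.exists_forall_lt_r (D := D) hV hδc (max b ν)
    obtain ⟨δ₁, h1, h2, h3, h4, δ₀, h5, h6, h7⟩ := hδ b' hb'
    have h8 := hr δ₁ h2 h3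
    exact ⟨D.r δ₁ δ, ⟨(le_max_right _ _).trans_lt h8, δ₁, h3, h4, h1.1.1, ⟨b', h2⟩, rfl, δ₀, h5,
      h6, h7⟩, ((le_max_left _ _).trans_lt h8).le⟩
  -- the upper parts of the walks
  have hup : ∀ j, ∃ (δ₀ : W) (l' : W), j ∈ K → δ₀ ∈ T ∧ δ < δ₀ ∧ D.r δ δ₀ = j ∧ l' < δ ∧
      ∀ ξ ∈ u (B δ₀), D.Passes δ ξ l' := by
    intro j
    by_cases hj : j ∈ K
    · obtain ⟨-, -, -, -, -, -, -, δ₀, h1, h2, h3⟩ := id hj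
      obtain ⟨l', hl', hp⟩ := WalkData.exists_passes_finset (D := D) hV hlδ hδc (u (B δ₀))
        fun ξ hξ => (h2.trans (hBu δ₀ ξ hξ)).le
      exact ⟨δ₀, l', fun _ => ⟨h1, h2, h3, hl', hp⟩⟩
    · exact ⟨w₀, w₀, fun h => absurd h hj⟩
  choose δ₀ l' hup using hup
  -- the lower parts of the walks
  have hlow : ∀ j, ∃ α, j ∈ K → α < δ ∧ ∀ ζ ∈ u α, ζ < δ ∧ D.r ζ δ = j := by
    intro j
    by_cases hj : j ∈ K
    · obtain ⟨-, δ₁, h1, h2, h3, ⟨y, hy⟩, h4, -⟩ := id hj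
      obtain ⟨b, hb, hp⟩ := WalkData.exists_passes (D := D) hV hy h3 δ h1.le
      have h5 := hG δ₁ h2 b hb
      refine ⟨B b, fun _ => ⟨(h5 _ (mem_insert _ _)).trans h1, fun ζ hζ => ?_⟩⟩
      have h6 : ζ < δ₁ := h5 ζ (mem_insert_of_mem _ hζ)
      refine ⟨h6.trans h1, ?_⟩
      rw [← h4]
      exact (hp ζ (hBu b ζ hζ) h6.le).2 δ (by rw [D.walk_of_lt h1]; exact List.mem_cons_self)
    · exact ⟨w₀, fun h => absurd h hj⟩
  choose α hα using hlow
  have hwalk : ∀ i ∈ K, ∀ ξ ∈ u (B (δ₀ i)), D.walk δ ξ = D.walk (δ₀ i) ξ ++ D.walk δ (δ₀ i) ∧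
      ∀ η ∈ D.walk (δ₀ i) ξ, D.r δ η ≤ ν := by
    intro i hi ξ hξ
    obtain ⟨h1, h2, h3, -, -⟩ := hup i hi
    obtain ⟨h4, h5⟩ := h1.2.1 ξ hξ δ hlδ h2.le
    exact ⟨h4, fun η hη => (h5 η hη).le.trans (h1.2.2 ξ hξ η hη)⟩
  -- The condition `r (l' i) δ < j` forces points with index `j` at `δ` to lie above `l' i`, so the
  -- walks to them from the upper set pass through `δ`.
  obtain ⟨i, hi, j, hj, hij, hc⟩ := hd K hK (fun i => D.r (l' i) δ)
    (fun i => (u (B (δ₀ i))).image fun ξ => D.trace δ ξ)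
    (fun j => (u (α j)).image fun ζ => D.trace ζ δ)
    (by
      intro i hi a ha
      obtain ⟨ξ, hξ, rfl⟩ := Finset.mem_image.1 ha
      obtain ⟨h1, h2, h3, -, -⟩ := hup i hi
      rw [WalkData.trace, (hwalk i hi ξ hξ).1, List.mem_toFinset, D.walk_of_lt h2]
      simp [h3])
    (by
      intro j hj a ha
      obtain ⟨ζ, hζ, rfl⟩ := Finset.mem_image.1 ha
      obtain ⟨h1, h2⟩ := (hα j hj).2 ζ hζ
      have := D.r_mem_trace h1
      rwa [h2] at this) ν
  obtain ⟨h1, h2, h3, h4, h5⟩ := hup i hi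
  obtain ⟨h6, h7⟩ := hα j hj
  refine ⟨α j, B (δ₀ i), (h6.trans h2).trans (hB _), fun ζ hζ ξ hξ => ?_⟩
  obtain ⟨h8, h9⟩ := h7 ζ hζ
  have hδξ : δ < ξ := h2.trans (hBu _ ξ hξ)
  have hζξ : ζ < ξ := h8.trans hδξ
  have hlζ : l' i < ζ := by
    by_contra hle
    exact ((D.r_mono (not_lt.1 hle) h4).trans_lt hij).ne h9
  have hp := h5 ξ hξ
  have hdν : d (D.trace ζ ξ) = ν := by
    rw [hp.trace_eq hlζ h8.le]
    exact hc _ (Finset.mem_image_of_mem _ hξ) _ (Finset.mem_image_of_mem _ hζ)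
  obtain ⟨h10, h11⟩ := hp ζ hlζ h8.le
  obtain ⟨h12, h13⟩ := hwalk i hi ξ hξ
  simp only [min_eq_left hζξ.le, max_eq_right hζξ.le, hdν]
  rw [D.pick_eq (η := δ₀ i) (l₁ := D.walk (δ₀ i) ξ)
    (l₂ := D.walk δ (D.f (δ₀ i) (D.r δ (δ₀ i))) ++ D.walk ζ δ)]
  · exact h1.1.2
  · rw [h10, h12, D.walk_of_lt h2]
    simp
  · intro η hη
    rw [h11 η (by rw [h12]; exact List.mem_append_left _ hη)]
    exact h13 η hη
  · rw [h11 (δ₀ i) (by rw [h12, D.walk_of_lt h2]; simp), h3]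
    exact hi.1

end

theorem pr1_of_colouring {lam : Cardinal.{0}} {c : lam.ord.ToType → lam.ord.ToType → lam.ord.ToType}
    (hsymm : ∀ ζ ξ, c ζ ξ = c ξ ζ)
    (hc : ∀ u : lam.ord.ToType → Finset lam.ord.ToType,
      (∀ α β, α < β → Disjoint (u α) (u β)) → ∀ γ, ∃ α β, α < β ∧
        ∀ ζ ∈ u α, ∀ ξ ∈ u β, c ζ ξ = γ) : Pr1 lam lam lam ℵ₀ := by
  refine ⟨c, hsymm, fun u hu hd γ => ?_⟩
  have hfin : ∀ α, (u α).Finite := fun α => lt_aleph0_iff_set_finite.1 (hu α)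
  obtain ⟨α, β, h3, h4⟩ := hc (fun α => (hfin α).toFinset)
    (fun α β h => by simpa using hd α β h) γ
  exact ⟨α, β, h3, fun ζ hζ ξ hξ => h4 ζ (by simpa using hζ) ξ (by simpa using hξ)⟩

/-! ### Cellularity and chain conditions -/

section Cellularity

variable {α : Type} [PartialOrder α] [OrderBot α]

theorem IsCellularFamily.mk_le_cellularity {S : Set α} (hS : IsCellularFamily S) :
    #S ≤ cellularity α :=
  le_ciSup (f := fun S : {S : Set α // IsCellularFamily S} => #S.1)
    bddAbove_of_small ⟨S, hS⟩

theorem ChainCondition.cellularity_le {κ : Cardinal.{0}} (h : ChainCondition (Order.succ κ) α) :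
    cellularity α ≤ κ :=
  ciSup_le' fun S => Order.lt_succ_iff.1 (h S.1 S.2)

theorem ChainCondition.mono {κ κ' : Cardinal.{0}} (h : ChainCondition κ α) (hle : κ ≤ κ') :
    ChainCondition κ' α :=
  fun S hS => (h S hS).trans_le hle

/-- The range of a family of pairwise disjoint nonzero elements. -/
theorem exists_isCellularFamily_mk_eq {ι : Type} (f : ι → α) (hf : ∀ i, f i ≠ ⊥)
    (hd : ∀ i j, i ≠ j → Disjoint (f i) (f j)) :
    ∃ S : Set α, IsCellularFamily S ∧ #S = #ι := by
  have hinj : Function.Injective f := by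
    intro i j hij
    by_contra hne
    have := hd i j hne
    rw [hij, disjoint_self] at this
    exact hf j this
  refine ⟨range f, ⟨?_, ?_⟩, mk_range_eq f hinj⟩
  · rintro ⟨i, hi⟩
    exact hf i hi
  · rintro _ ⟨i, rfl⟩ _ ⟨j, rfl⟩ hij
    exact hd i j fun h => hij (by rw [h])

/-- The cellularity is `κ⁺`, and the `κ⁺`-chain condition fails, if there is a family of `κ⁺`
many pairwise disjoint nonzero elements and no larger one. -/
theorem cellularity_eq_and_not_chainCondition {ι : Type} (f : ι → α) (hf : ∀ i, f i ≠ ⊥)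
    (hd : ∀ i j, i ≠ j → Disjoint (f i) (f j)) (hle : ∀ S : Set α, IsCellularFamily S → #S ≤ #ι) :
    cellularity α = #ι ∧ ¬ ChainCondition #ι α := by
  obtain ⟨S, hS, hSι⟩ := exists_isCellularFamily_mk_eq f hf hd
  refine ⟨le_antisymm (ciSup_le' fun S => hle S.1 S.2) ?_, fun h => ?_⟩
  · rw [← hSι]
    exact hS.mk_le_cellularity
  · exact (h S hS).ne hSι

end Cellularity

/-! ### Finite cliques and their amalgamation -/

section FiniteClique

theorem mk_finset_le_max (X : Type) : #(Finset X) ≤ max ℵ₀ #X := by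
  classical
  refine le_trans ?_ (mk_list_le_max X)
  exact mk_le_of_surjective (f := List.toFinset)
    fun s => ⟨s.toList, Finset.toList_toFinset s⟩

variable {W : Type}

/-- The finite cliques of a graph. -/
def FiniteClique (G : SimpleGraph W) : Type := {H : Finset W // G.IsClique (H : Set W)}

/-- The clique with one vertex. -/
def FiniteClique.single (G : SimpleGraph W) (x : W) : FiniteClique G := ⟨{x}, by simp⟩

theorem mk_finiteClique_le (G : SimpleGraph W) : #(FiniteClique G) ≤ max ℵ₀ #W :=
  (mk_subtype_le _).trans (mk_finset_le_max W)

theorem FiniteClique.adj {G : SimpleGraph W} (H : FiniteClique G) {x y : W} (hx : x ∈ H.1)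
    (hy : y ∈ H.1) (hxy : x ≠ y) : G.Adj x y :=
  H.2 (Finset.mem_coe.2 hx) (Finset.mem_coe.2 hy) hxy

end FiniteClique

section Cliques

variable {κ : Cardinal.{0}} {W : Type} [LinearOrder W]

theorem IsSuccCardOrder.nonempty_embedding (hW : IsSuccCardOrder κ W) {A : Set W}
    (hA : ∀ b, ∃ x ∈ A, b ≤ x) : Nonempty (W ↪ A) := by
  have h : #W ≤ #A := by
    refine hW.card_le.trans (Order.succ_le_of_lt ?_)
    by_contra hle
    obtain ⟨b, hb⟩ := hW.exists_gt _ (not_lt.1 hle)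
    obtain ⟨x, hx, hbx⟩ := hA b
    exact (hb x hx).not_ge hbx
  exact h

/-- Every disjoint family of finite sets of vertices, indexed by the vertices, has two members
that are completely joined. -/
def SimpleGraph.JoinsDisjointFamilies (G : SimpleGraph W) : Prop :=
  ∀ u : W → Finset W, (∀ α β, α ≠ β → Disjoint (u α) (u β)) →
    ∃ α β, α ≠ β ∧ ∀ ζ ∈ u α, ∀ ξ ∈ u β, G.Adj ζ ξ

/-- Two edge-disjoint graphs as above, with `κ` many isolated vertices. -/
theorem exists_graphs (hW : IsSuccCardOrder κ W) (hκ : κ ≤ #W) {c : W → W → W}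
    (hsymm : ∀ ζ ξ, c ζ ξ = c ξ ζ)
    (hc : ∀ u : W → Finset W, (∀ α β, α < β → Disjoint (u α) (u β)) → ∀ γ, ∃ α β, α < β ∧
        ∀ ζ ∈ u α, ∀ ξ ∈ u β, c ζ ξ = γ) :
    ∃ (G₀ G₁ : SimpleGraph W) (D : Set W), #D = κ ∧ G₀.JoinsDisjointFamilies ∧
      G₁.JoinsDisjointFamilies ∧ (∀ x ∈ D, ∀ y, ¬ G₀.Adj x y) ∧ (∀ x ∈ D, ∀ y, ¬ G₁.Adj x y) ∧
      ∀ x y, G₀.Adj x y → ¬ G₁.Adj x y := by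
  obtain ⟨D, hD⟩ := le_mk_iff_exists_set.1 hκ
  obtain ⟨γ₀⟩ := hW.nonempty
  obtain ⟨γ₁, hγ⟩ := hW.exists_gt' γ₀
  let G : W → SimpleGraph W := fun γ =>
    { Adj := fun x y => x ≠ y ∧ x ∉ D ∧ y ∉ D ∧ c x y = γ
      symm := ⟨fun x y h => ⟨h.1.symm, h.2.2.1, h.2.1, by rw [hsymm]; exact h.2.2.2⟩⟩
      loopless := ⟨fun x h => h.1 rfl⟩ }
  have hG : ∀ γ, (G γ).JoinsDisjointFamilies := by
    intro γ u hu
    obtain ⟨b, hb⟩ := hW.exists_gt D hD.le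
    -- Edges meeting `D` were deleted, so the family is thinned to members lying above `D`.
    obtain ⟨e⟩ := hW.nonempty_embedding (A := {β | ∀ ξ ∈ u β, b < ξ}) fun x => by
      obtain ⟨β, h1, h2⟩ := hW.exists_index_forall_lt (fun α β h => hu α β h.ne) (max b x)
      exact ⟨β, fun ξ hξ => (le_max_left _ _).trans_lt (h2 ξ hξ), ((le_max_right _ _).trans_lt h1).le⟩
    have hdis : ∀ α β, α ≠ β → Disjoint (u (e α)) (u (e β)) := fun α β h =>
      hu _ _ fun h' => h (e.injective (Subtype.ext h'))
    obtain ⟨α, β, h1, h2⟩ := hc (fun α => u (e α)) (fun α β h => hdis α β h.ne) γ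
    refine ⟨e α, e β, fun h' => h1.ne (e.injective (Subtype.ext h')), fun ζ hζ ξ hξ =>
      ⟨fun h => Finset.disjoint_left.1 (hdis α β h1.ne) hζ (h ▸ hξ),
        fun h => ((e α).2 ζ hζ).not_gt (hb ζ h), fun h => ((e β).2 ξ hξ).not_gt (hb ξ h),
        h2 ζ hζ ξ hξ⟩⟩
  exact ⟨G γ₀, G γ₁, D, hD, hG γ₀, hG γ₁, fun x hx y h => h.2.1 hx, fun x hx y h => h.2.1 hx,
    fun x y h h' => hγ.ne (h.2.2.2.symm.trans h'.2.2.2)⟩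

/-- Among `κ⁺` many cliques, each given up to a finite set of vertices, two are amalgamated by
a third one. -/
theorem exists_amalgam (hW : IsSuccCardOrder κ W) {G : SimpleGraph W}
    (hG : G.JoinsDisjointFamilies) (s : W → Finset W) (H : W → FiniteClique G) :
    ∃ α β, α ≠ β ∧ ∃ H' : FiniteClique G, (∀ x ∈ s α, x ∈ H'.1 ↔ x ∈ (H α).1) ∧
      ∀ x ∈ s β, x ∈ H'.1 ↔ x ∈ (H β).1 := by
  classical
  obtain ⟨w₀⟩ := hW.nonempty
  obtain ⟨F, hF⟩ := hW.exists_closure (fun x => (s x : Set W)) fun x =>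
    (le_aleph0_iff_set_countable.2 (s x).countable_toSet).trans hW.aleph0_le
  let p : W → Finset W := fun α => s α ∩ (H α).1
  -- Δ-system: pressing down bounds `s δ ∩ δ`, after which only κ many roots and traces of the
  -- clique on the root remain. Closure under `F` makes the sets disjoint off the common root.
  obtain ⟨c, hc⟩ := (hW.isStat_univ.inter_closurePoints hW F w₀).fodor hW
    (fun δ c => ∀ x ∈ s δ, x < δ → x ≤ c) (by
      rintro δ ⟨-, hw, -⟩
      refine ⟨(insert w₀ ((s δ).filter (· < δ))).max' (by simp), ?_, fun x hx hxδ =>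
        Finset.le_max' _ _ (by simp [hx, hxδ])⟩
      rw [Finset.max'_lt_iff]
      intro x hx
      rcases Finset.mem_insert.1 hx with rfl | hx
      · exact hw
      · exact (Finset.mem_filter.1 hx).2)
  have hcard : #(Finset (Iic c)) ≤ κ :=
    (mk_finset_le_max _).trans (max_le hW.aleph0_le (hW.card_Iic_le c))
  let emb : Finset (Iic c) → Finset W := fun R => R.map (Function.Embedding.subtype _)
  have hemb : ∀ R : Finset W, (∀ x ∈ R, x ≤ c) → emb (R.subtype (· ∈ Iic c)) = R := by
    intro R hR
    simp only [emb, Finset.subtype_map]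
    exact Finset.filter_true_of_mem hR
  obtain ⟨⟨R, R'⟩, hA⟩ := hc.exists_of_subset_iUnion hW
    (ι := Finset (Iic c) × Finset (Iic c)) (by
      rw [mk_prod]
      simp only [lift_id]
      exact mul_le_of_le hW.aleph0_le hcard hcard)
    (fun q => {δ | IsClosurePoint F δ ∧ (s δ).filter (· < δ) = emb q.1 ∧
      (p δ).filter (· < δ) = emb q.2}) (by
      rintro δ ⟨⟨-, -, hδF⟩, hδ⟩
      refine mem_iUnion.2 ⟨(((s δ).filter (· < δ)).subtype (· ∈ Iic c),
        ((p δ).filter (· < δ)).subtype (· ∈ Iic c)), hδF, (hemb _ ?_).symm, (hemb _ ?_).symm⟩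
      · intro x hx
        obtain ⟨h1, h2⟩ := Finset.mem_filter.1 hx
        exact hδ x h1 h2
      · intro x hx
        obtain ⟨h1, h2⟩ := Finset.mem_filter.1 hx
        exact hδ x (Finset.mem_inter.1 h1).1 h2)
  obtain ⟨e⟩ := hW.nonempty_embedding fun b => by
    obtain ⟨δ, hδ, hb, -⟩ := hA id b
    exact ⟨δ, hδ, hb.le⟩
  have hR : ∀ α x, x ∈ emb R ↔ x ∈ s (e α) ∧ x < e α := fun α x => by
    have h := Finset.ext_iff.1 (e α).2.2.1 x
    rw [Finset.mem_filter] at h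
    exact h.symm
  have hR' : ∀ α x, x ∈ emb R' ↔ x ∈ p (e α) ∧ x < e α := fun α x => by
    have h := Finset.ext_iff.1 (e α).2.2.2 x
    rw [Finset.mem_filter] at h
    exact h.symm
  have hRp : ∀ α x, x ∈ emb R → x ∈ p (e α) → x ∈ emb R' := fun α x h h' =>
    (hR' α x).2 ⟨h', ((hR α x).1 h).2⟩
  have hdis' : ∀ α β, (e α : W) < e β → Disjoint (s (e α) \ emb R) (s (e β) \ emb R) := by
    intro α β hlt
    rw [Finset.disjoint_left]
    intro x hx hx'
    rw [Finset.mem_sdiff] at hx hx'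
    exact hx'.2 ((hR β x).2 ⟨hx'.1, hF _ (e β).2.1 _ hlt x hx.1⟩)
  have hdis : ∀ α β, α ≠ β → Disjoint (s (e α) \ emb R) (s (e β) \ emb R) := by
    intro α β h
    have hne : (e α : W) ≠ e β := fun h' => h (e.injective (Subtype.ext h'))
    rcases lt_or_gt_of_ne hne with h1 | h1
    · exact hdis' α β h1
    · exact (hdis' β α h1).symm
  obtain ⟨α, β, hne, hadj⟩ := hG (fun α => s (e α) \ emb R) hdis
  have hps : ∀ α x, x ∈ p α → x ∈ s α := fun α x h => (Finset.mem_inter.1 h).1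
  have hpH : ∀ α x, x ∈ p α → x ∈ (H α).1 := fun α x h => (Finset.mem_inter.1 h).2
  have hcross : ∀ x ∈ p (e α), ∀ y ∈ p (e β), x ≠ y → G.Adj x y := by
    intro x hx y hy hxy
    by_cases hxR : x ∈ emb R
    · exact (H (e β)).adj (hpH _ _ ((hR' β x).1 (hRp α x hxR hx)).1) (hpH _ _ hy) hxy
    by_cases hyR : y ∈ emb R
    · exact (H (e α)).adj (hpH _ _ hx) (hpH _ _ ((hR' α y).1 (hRp β y hyR hy)).1) hxy
    exact hadj x (Finset.mem_sdiff.2 ⟨hps _ _ hx, hxR⟩) y (Finset.mem_sdiff.2 ⟨hps _ _ hy, hyR⟩)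
  have hagree : ∀ α β, α ≠ β → ∀ x ∈ s (e α), x ∈ p (e β) → x ∈ p (e α) := by
    intro α β hne x hx hx'
    by_cases hxR : x ∈ emb R
    · exact ((hR' α x).1 (hRp β x hxR hx')).1
    · exact absurd (Finset.mem_sdiff.2 ⟨hps _ _ hx', hxR⟩)
        (Finset.disjoint_left.1 (hdis α β hne) (Finset.mem_sdiff.2 ⟨hx, hxR⟩))
  refine ⟨e α, e β, fun h => hne (e.injective (Subtype.ext h)),
    ⟨p (e α) ∪ p (e β), ?_⟩, fun x hx => ⟨fun h => ?_, fun h => ?_⟩,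
    fun x hx => ⟨fun h => ?_, fun h => ?_⟩⟩
  · intro x hx y hy hxy
    rw [Finset.mem_coe, Finset.mem_union] at hx hy
    rcases hx with hx | hx <;> rcases hy with hy | hy
    · exact (H (e α)).adj (hpH _ _ hx) (hpH _ _ hy) hxy
    · exact hcross x hx y hy hxy
    · exact (hcross y hy x hx hxy.symm).symm
    · exact (H (e β)).adj (hpH _ _ hx) (hpH _ _ hy) hxy
  · rcases Finset.mem_union.1 h with h | h
    · exact hpH _ _ h
    · exact hpH _ _ (hagree α β hne x hx h)
  · exact Finset.mem_union_left _ (Finset.mem_inter.2 ⟨hx, h⟩)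
  · rcases Finset.mem_union.1 h with h | h
    · exact hpH _ _ (hagree β α hne.symm x hx h)
    · exact hpH _ _ h
  · exact Finset.mem_union_right _ (Finset.mem_inter.2 ⟨hx, h⟩)

/-- A partial order whose nonzero elements are witnessed by finitely determined sets of cliques
satisfies the `κ⁺`-chain condition. -/
theorem chainCondition_of_cliques (hW : IsSuccCardOrder κ W) {G : SimpleGraph W}
    (hG : G.JoinsDisjointFamilies) {α : Type} [PartialOrder α] [OrderBot α]
    (mem : FiniteClique G → α → Prop)
    (h1 : ∀ a : α, a ≠ ⊥ → ∃ (s : Finset W) (H : FiniteClique G), ∀ H' : FiniteClique G,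
      (∀ x ∈ s, x ∈ H'.1 ↔ x ∈ H.1) → mem H' a)
    (h2 : ∀ a b H, mem H a → mem H b → ¬ Disjoint a b) : ChainCondition (Order.succ κ) α := by
  intro S hS
  by_contra hle
  obtain ⟨e⟩ := hW.card_le.trans (not_lt.1 hle)
  have hne : ∀ x, (e x : α) ≠ ⊥ := fun x h => hS.1 (h ▸ (e x).2)
  choose s H hsH using fun x => h1 (e x) (hne x)
  obtain ⟨x, y, hxy, H', hx, hy⟩ := exists_amalgam hW hG s H
  refine h2 _ _ H' (hsH x H' hx) (hsH y H' hy) (hS.2 (e x).2 (e y).2 fun h => hxy ?_)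
  exact e.injective (Subtype.ext h)

end Cliques

/-! ### The spaces of finite cliques -/

section Topology

open TopologicalSpace

variable {κ : Cardinal.{0}} {W : Type} [LinearOrder W]

/-- The topology of pointwise convergence on the finite cliques, as a subspace of `2^W`. -/
instance (G : SimpleGraph W) : TopologicalSpace (FiniteClique G) :=
  TopologicalSpace.induced (fun (H : FiniteClique G) (x : W) => decide (x ∈ H.1)) inferInstance

/-- The open set of the cliques that contain a given vertex. -/
def cliquesThrough (G : SimpleGraph W) (x : W) : Opens (FiniteClique G) where
  carrier := {H | x ∈ H.1}
  is_open' := by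
    refine isOpen_induced_iff.2 ⟨{f | f x = true}, ?_, by ext; simp⟩
    exact (isOpen_discrete ({true} : Set Bool)).preimage
      (continuous_apply (A := fun _ : W => Bool) x)

theorem opens_disjoint {X : Type} [TopologicalSpace X] {O O' : Opens X}
    (h : ∀ x, x ∈ O → x ∈ O' → False) : Disjoint O O' := by
  rw [disjoint_iff]
  exact Opens.ext (Set.eq_empty_of_forall_notMem fun x hx => h x hx.1 hx.2)

theorem exists_finset_of_isOpen {G : SimpleGraph W} {O : Set (FiniteClique G)} (hO : IsOpen O)
    {H : FiniteClique G} (hH : H ∈ O) : ∃ s : Finset W, ∀ H' : FiniteClique G,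
      (∀ x ∈ s, x ∈ H'.1 ↔ x ∈ H.1) → H' ∈ O := by
  obtain ⟨U, hU, rfl⟩ := isOpen_induced_iff.1 hO
  obtain ⟨s, t, h1, h2⟩ := isOpen_pi_iff.1 hU _ hH
  refine ⟨s, fun H' hH' => h2 fun x hx => ?_⟩
  have : decide (x ∈ H'.1) = decide (x ∈ H.1) := by simp [hH' x hx]
  simp only [this]
  exact (h1 x hx).2

theorem spaceChainCondition_finiteClique (hW : IsSuccCardOrder κ W) {G : SimpleGraph W}
    (hG : G.JoinsDisjointFamilies) : SpaceChainCondition (Order.succ κ) (FiniteClique G) := by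
  refine chainCondition_of_cliques hW hG (fun H O => H ∈ O) (fun O hO => ?_)
    fun O O' H h h' hd => ?_
  · obtain ⟨H, hH⟩ := (Opens.ne_bot_iff_nonempty O).1 hO
    obtain ⟨s, hs⟩ := exists_finset_of_isOpen O.isOpen hH
    exact ⟨s, H, hs⟩
  · have : H ∈ O ⊓ O' := ⟨h, h'⟩
    rw [hd.eq_bot] at this
    exact this

theorem single_mem_cliquesThrough (G : SimpleGraph W) (x : W) :
    FiniteClique.single G x ∈ cliquesThrough G x := by
  change x ∈ ({x} : Finset W)
  simp

theorem spaceCellularity_finiteClique (hW : IsSuccCardOrder κ W) {G : SimpleGraph W}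
    (hG : G.JoinsDisjointFamilies) {D : Set W} (hD : #D = κ) (hDG : ∀ x ∈ D, ∀ y, ¬ G.Adj x y) :
    spaceCellularity (FiniteClique G) = κ := by
  refine le_antisymm (ChainCondition.cellularity_le (spaceChainCondition_finiteClique hW hG)) ?_
  obtain ⟨S, hS, hSD⟩ := exists_isCellularFamily_mk_eq (fun x : D => cliquesThrough G x)
    (fun x => (Opens.ne_bot_iff_nonempty _).2 ⟨_, single_mem_cliquesThrough G x⟩)
    fun x y hxy => opens_disjoint fun H hx hy =>
      hDG x x.2 y (H.adj hx hy fun h => hxy (Subtype.ext h))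
  rw [← hD, ← hSD]
  exact hS.mk_le_cellularity

theorem mk_le_of_isCellularFamily_opens {X : Type} [TopologicalSpace X] {S : Set (Opens X)}
    (hS : IsCellularFamily S) : #S ≤ #X := by
  have h1 : ∀ O : S, ∃ x, x ∈ O.1 := fun O =>
    (Opens.ne_bot_iff_nonempty O.1).1 fun h => hS.1 (h ▸ O.2)
  choose f hf using h1
  refine mk_le_of_injective (f := f) fun O O' h => ?_
  by_contra hne
  have hd : Disjoint O.1 O'.1 := hS.2 O.2 O'.2 fun h => hne (Subtype.ext h)
  have : f O ∈ O.1 ⊓ O'.1 := ⟨hf O, h ▸ hf O'⟩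
  rw [hd.eq_bot] at this
  exact this

/-- The boxes of pairs of cliques through a common vertex are disjoint; the product has only `#W`
points, which bounds every cellular family. -/
theorem spaceCellularity_prod_finiteClique (hW : ℵ₀ ≤ #W) {G₀ G₁ : SimpleGraph W}
    (hdis : ∀ x y, G₀.Adj x y → ¬ G₁.Adj x y) :
    spaceCellularity (FiniteClique G₀ × FiniteClique G₁) = #W ∧
      ¬ SpaceChainCondition #W (FiniteClique G₀ × FiniteClique G₁) := by
  refine cellularity_eq_and_not_chainCondition
    (fun x : W => (⟨_, (cliquesThrough G₀ x).isOpen.prod (cliquesThrough G₁ x).isOpen⟩ :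
      Opens (FiniteClique G₀ × FiniteClique G₁))) (fun x => ?_)
    (fun x y hxy => ?_) fun S hS => ?_
  · exact (Opens.ne_bot_iff_nonempty _).2 ⟨(FiniteClique.single G₀ x, FiniteClique.single G₁ x),
      single_mem_cliquesThrough G₀ x, single_mem_cliquesThrough G₁ x⟩
  · refine opens_disjoint fun H hx hy => ?_
    exact hdis x y (H.1.adj hx.1 hy.1 hxy) (H.2.adj hx.2 hy.2 hxy)
  · refine (mk_le_of_isCellularFamily_opens hS).trans ?_
    rw [mk_prod]
    simp only [lift_id]
    exact mul_le_of_le hW ((mk_finiteClique_le G₀).trans (max_le hW le_rfl))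
      ((mk_finiteClique_le G₁).trans (max_le hW le_rfl))

end Topology

/-! ### Free products as tensor products of Boolean rings -/

section FreeProduct

/-- The tensor product of two Boolean rings. -/
def BoolTensor (R S : Type) [BooleanRing R] [BooleanRing S] : Type := R ⊗[ℤ] S

variable {R S : Type} [BooleanRing R] [BooleanRing S]

theorem tensor_isIdempotentElem (x : R ⊗[ℤ] S) : IsIdempotentElem x := by
  have h2 : (1 : R ⊗[ℤ] S) + 1 = 0 := by
    rw [Algebra.TensorProduct.one_def, ← TensorProduct.add_tmul, BooleanRing.add_self,
      TensorProduct.zero_tmul]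
  induction x using TensorProduct.induction_on with
  | zero => exact IsIdempotentElem.zero
  | tmul a b =>
    rw [IsIdempotentElem, Algebra.TensorProduct.tmul_mul_tmul, BooleanRing.mul_self,
      BooleanRing.mul_self]
  | add x y hx hy =>
    rw [IsIdempotentElem] at *
    calc (x + y) * (x + y) = x * x + y * y + x * y * (1 + 1) := by ring
      _ = x + y := by rw [hx, hy, h2, mul_zero, add_zero]

instance : BooleanRing (BoolTensor R S) :=
  { (inferInstance : Ring (R ⊗[ℤ] S)) with
    isIdempotentElem := tensor_isIdempotentElem }

/-- The inclusion of the left factor. -/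
def BoolTensor.inl : R →+* BoolTensor R S :=
  (Algebra.TensorProduct.includeLeft : R →ₐ[ℤ] R ⊗[ℤ] S).toRingHom

/-- The inclusion of the right factor. -/
def BoolTensor.inr : S →+* BoolTensor R S :=
  (Algebra.TensorProduct.includeRight : S →ₐ[ℤ] R ⊗[ℤ] S).toRingHom

/-- Ring homomorphisms out of the tensor product. -/
def BoolTensor.lift {T : Type} [CommRing T] (f : R →+* T) (g : S →+* T) : BoolTensor R S →+* T :=
  (Algebra.TensorProduct.productMap f.toIntAlgHom g.toIntAlgHom).toRingHom

theorem BoolTensor.lift_inl {T : Type} [CommRing T] (f : R →+* T) (g : S →+* T) (a : R) :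
    BoolTensor.lift f g (BoolTensor.inl a) = f a :=
  Algebra.TensorProduct.productMap_left_apply f.toIntAlgHom g.toIntAlgHom a

theorem BoolTensor.lift_inr {T : Type} [CommRing T] (f : R →+* T) (g : S →+* T) (b : S) :
    BoolTensor.lift f g (BoolTensor.inr b) = g b :=
  Algebra.TensorProduct.productMap_right_apply f.toIntAlgHom g.toIntAlgHom b

theorem BoolTensor.induction {p : BoolTensor R S → Prop} (h0 : p 0)
    (hm : ∀ a b, p (BoolTensor.inl a * BoolTensor.inr b)) (ha : ∀ x y, p x → p y → p (x + y))
    (x : BoolTensor R S) : p x := by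
  refine TensorProduct.induction_on (motive := p) x h0 (fun a b => ?_) ha
  have h : (BoolTensor.inl a * BoolTensor.inr b : BoolTensor R S) = (a ⊗ₜ[ℤ] b : R ⊗[ℤ] S) := by
    change (a ⊗ₜ[ℤ] (1 : S)) * ((1 : R) ⊗ₜ[ℤ] b) = a ⊗ₜ[ℤ] b
    rw [Algebra.TensorProduct.tmul_mul_tmul, mul_one, one_mul]
  rw [← h]
  exact hm a b

theorem mk_boolTensor_le : #(BoolTensor R S) ≤ max ℵ₀ (#R * #S) := by
  refine le_trans ?_ ((mk_list_le_max (R × S)).trans_eq (by rw [mk_prod]; simp))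
  refine mk_le_of_surjective (f := fun l : List (R × S) =>
    ((l.map fun q => BoolTensor.inl q.1 * BoolTensor.inr q.2).sum : BoolTensor R S)) fun x => ?_
  induction x using BoolTensor.induction with
  | h0 => exact ⟨[], rfl⟩
  | hm a b => exact ⟨[(a, b)], by simp⟩
  | ha x y hx hy =>
    obtain ⟨l, rfl⟩ := hx
    obtain ⟨l', rfl⟩ := hy
    exact ⟨l ++ l', by simp⟩

/-- Ring homomorphisms into `AsBoolRing D` as lattice homomorphisms into `D`. -/
def RingHom.toLatticeHom {D : Type} [BooleanAlgebra D] (f : R →+* AsBoolRing D) :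
    BoundedLatticeHom (AsBoolAlg R) D where
  toFun a := ofBoolRing (f (ofBoolAlg a))
  map_sup' a b := by
    rw [ofBoolAlg_sup, map_add f, map_add f, map_mul f, ofBoolRing_add, ofBoolRing_add, ofBoolRing_mul]
    exact symmDiff_symmDiff_inf _ _
  map_inf' a b := by rw [ofBoolAlg_inf, map_mul f, ofBoolRing_mul]
  map_top' := by rw [ofBoolAlg_top, map_one, ofBoolRing_one]
  map_bot' := by rw [ofBoolAlg_bot, map_zero, ofBoolRing_zero]

/-- Lattice homomorphisms into `D` as ring homomorphisms into `AsBoolRing D`. -/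
def BoundedLatticeHom.toRingHom {D : Type} [BooleanAlgebra D]
    (f : BoundedLatticeHom (AsBoolAlg R) D) : R →+* AsBoolRing D :=
  f.asBoolRing.comp (RingEquiv.asBoolRingAsBoolAlg R).symm.toRingHom

/-- The tensor product of Boolean rings is the free product of Boolean algebras. -/
theorem isFreeProduct_boolTensor :
    IsFreeProduct (BoolTensor.inl : R →+* BoolTensor R S).asBoolAlg
      (BoolTensor.inr : S →+* BoolTensor R S).asBoolAlg := by
  intro D _ f g
  refine ⟨(BoolTensor.lift f.toRingHom g.toRingHom).toLatticeHom, ⟨?_, ?_⟩, ?_⟩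
  · ext a
    exact congrArg ofBoolRing (BoolTensor.lift_inl f.toRingHom g.toRingHom (ofBoolAlg a))
  · ext b
    exact congrArg ofBoolRing (BoolTensor.lift_inr f.toRingHom g.toRingHom (ofBoolAlg b))
  · rintro h ⟨rfl, rfl⟩
    ext x
    refine congrArg ofBoolRing (?_ : h.toRingHom (ofBoolAlg x) = BoolTensor.lift _ _ (ofBoolAlg x))
    induction ofBoolAlg x using BoolTensor.induction with
    | h0 => simp only [map_zero]
    | hm a b =>
      rw [map_mul, map_mul, BoolTensor.lift_inl, BoolTensor.lift_inr]
      rfl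
    | ha x y hx hy => rw [map_add, map_add, hx, hy]

end FreeProduct

/-! ### The Boolean algebras of finite cliques -/

section CliqueRing

variable {κ : Cardinal.{0}} {W : Type} [LinearOrder W]

/-- The indicator function of the cliques that contain `x`. -/
def coordFun (G : SimpleGraph W) (x : W) (H : FiniteClique G) : ZMod 2 := if x ∈ H.1 then 1 else 0

/-- The Boolean ring of functions generated by the indicator functions `coordFun G x`. -/
def CliqueRing (G : SimpleGraph W) : Type :=
  Algebra.adjoin (ZMod 2) (range (coordFun G))

instance (G : SimpleGraph W) : BooleanRing (CliqueRing G) :=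
  { (inferInstance : Ring (Algebra.adjoin (ZMod 2) (range (coordFun G)))) with
    isIdempotentElem := fun f => by
      refine Subtype.ext (funext fun H => ?_)
      exact (by decide : ∀ a : ZMod 2, a * a = a) (f.1 H) }

/-- Evaluation at a clique. -/
def CliqueRing.eval {G : SimpleGraph W} (H : FiniteClique G) : CliqueRing G →+* ZMod 2 :=
  (Pi.evalRingHom (fun _ : FiniteClique G => ZMod 2) H).comp
    (Algebra.adjoin (ZMod 2) (range (coordFun G))).val.toRingHom

theorem CliqueRing.ext {G : SimpleGraph W} {f g : CliqueRing G}
    (h : ∀ H, CliqueRing.eval H f = CliqueRing.eval H g) : f = g :=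
  Subtype.ext (funext h)

/-- The generators of the ring. -/
def CliqueRing.coord (G : SimpleGraph W) (x : W) : CliqueRing G :=
  ⟨coordFun G x, Algebra.subset_adjoin ⟨x, rfl⟩⟩

theorem CliqueRing.eval_coord {G : SimpleGraph W} (H : FiniteClique G) (x : W) :
    CliqueRing.eval H (CliqueRing.coord G x) = if x ∈ H.1 then 1 else 0 := rfl

theorem mk_cliqueRing_le (G : SimpleGraph W) : #(CliqueRing G) ≤ max ℵ₀ #W := by
  refine (Algebra.cardinalMk_adjoin_le (ZMod 2) (range (coordFun G))).trans ?_
  refine max_le (max_le (mk_le_aleph0.trans (le_max_left _ _)) ?_) (le_max_left _ _)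
  exact mk_range_le.trans (le_max_right _ _)

/-- Elements of the ring are finitely determined. -/
theorem CliqueRing.exists_support {G : SimpleGraph W} (f : CliqueRing G) :
    ∃ s : Finset W, ∀ H H' : FiniteClique G, (∀ x ∈ s, x ∈ H'.1 ↔ x ∈ H.1) →
      CliqueRing.eval H' f = CliqueRing.eval H f := by
  classical
  obtain ⟨f, hf⟩ := f
  change ∃ s : Finset W, ∀ H H' : FiniteClique G, (∀ x ∈ s, x ∈ H'.1 ↔ x ∈ H.1) → f H' = f H
  induction hf using Algebra.adjoin_induction with
  | mem f hf =>
    obtain ⟨x, rfl⟩ := hf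
    exact ⟨{x}, fun H H' h => by simp only [coordFun, h x (Finset.mem_singleton_self x)]⟩
  | algebraMap r => exact ⟨∅, fun H H' _ => rfl⟩
  | add f g _ _ hf hg =>
    obtain ⟨s, hs⟩ := hf
    obtain ⟨t, ht⟩ := hg
    refine ⟨s ∪ t, fun H H' h => ?_⟩
    rw [Pi.add_apply, Pi.add_apply, hs H H' fun x hx => h x (Finset.mem_union_left _ hx),
      ht H H' fun x hx => h x (Finset.mem_union_right _ hx)]
  | mul f g _ _ hf hg =>
    obtain ⟨s, hs⟩ := hf
    obtain ⟨t, ht⟩ := hg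
    refine ⟨s ∪ t, fun H H' h => ?_⟩
    rw [Pi.mul_apply, Pi.mul_apply, hs H H' fun x hx => h x (Finset.mem_union_left _ hx),
      ht H H' fun x hx => h x (Finset.mem_union_right _ hx)]

theorem disjoint_toBoolAlg_iff {R : Type} [BooleanRing R] {a b : AsBoolAlg R} :
    Disjoint a b ↔ ofBoolAlg a * ofBoolAlg b = 0 := by
  rw [disjoint_iff, ← ofBoolAlg_inj, ofBoolAlg_inf, ofBoolAlg_bot]

/-- A nonzero function is nonzero at some clique, hence at all cliques agreeing with it on a finite
support. -/
theorem chainCondition_cliqueRing (hW : IsSuccCardOrder κ W) {G : SimpleGraph W}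
    (hG : G.JoinsDisjointFamilies) :
    ChainCondition (Order.succ κ) (AsBoolAlg (CliqueRing G)) := by
  refine chainCondition_of_cliques hW hG (fun H a => CliqueRing.eval H (ofBoolAlg a) ≠ 0)
    (fun a ha => ?_) fun a b H h h' hd => ?_
  · have hex : ∃ H, CliqueRing.eval H (ofBoolAlg a) ≠ 0 := by
      by_contra hcon
      push Not at hcon
      refine ha (ofBoolAlg_inj.1 (CliqueRing.ext fun H => ?_))
      rw [hcon H, ofBoolAlg_bot, map_zero]
    obtain ⟨H, hH⟩ := hex
    obtain ⟨s, hs⟩ := CliqueRing.exists_support (ofBoolAlg a)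
    exact ⟨s, H, fun H' h => by rwa [hs H H' h]⟩
  · have := congrArg (CliqueRing.eval H) (disjoint_toBoolAlg_iff.1 hd)
    rw [map_mul, map_zero] at this
    exact mul_ne_zero h h' this

theorem CliqueRing.coord_mul_coord {G : SimpleGraph W} {x y : W} (hxy : x ≠ y)
    (h : ¬ G.Adj x y) : CliqueRing.coord G x * CliqueRing.coord G y = 0 := by
  refine CliqueRing.ext fun H => ?_
  rw [map_mul, map_zero, CliqueRing.eval_coord, CliqueRing.eval_coord]
  by_cases hx : x ∈ H.1
  · by_cases hy : y ∈ H.1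
    · exact absurd (H.adj hx hy hxy) h
    · simp [hy]
  · simp [hx]

theorem CliqueRing.eval_single_coord (G : SimpleGraph W) (x : W) :
    CliqueRing.eval (FiniteClique.single G x) (CliqueRing.coord G x) = 1 := by
  rw [CliqueRing.eval_coord]
  exact if_pos (Finset.mem_singleton_self x)

theorem CliqueRing.coord_ne_zero (G : SimpleGraph W) (x : W) : CliqueRing.coord G x ≠ 0 := by
  intro h
  have := CliqueRing.eval_single_coord G x
  rw [h, map_zero] at this
  exact zero_ne_one this

theorem cellularity_cliqueRing (hW : IsSuccCardOrder κ W) {G : SimpleGraph W}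
    (hG : G.JoinsDisjointFamilies) {D : Set W} (hD : #D = κ) (hDG : ∀ x ∈ D, ∀ y, ¬ G.Adj x y) :
    cellularity (AsBoolAlg (CliqueRing G)) = κ := by
  refine le_antisymm (chainCondition_cliqueRing hW hG).cellularity_le ?_
  obtain ⟨S, hS, hSD⟩ := exists_isCellularFamily_mk_eq
    (fun x : D => toBoolAlg (CliqueRing.coord G x))
    (fun x h => CliqueRing.coord_ne_zero G x (toBoolAlg_inj.1 h))
    fun x y hxy => disjoint_toBoolAlg_iff.2
      (CliqueRing.coord_mul_coord (fun h => hxy (Subtype.ext h)) (hDG x x.2 y))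
  rw [← hD, ← hSD]
  exact hS.mk_le_cellularity

theorem cellularity_boolTensor_cliqueRing (hW : ℵ₀ ≤ #W) {G₀ G₁ : SimpleGraph W}
    (hdis : ∀ x y, G₀.Adj x y → ¬ G₁.Adj x y) :
    cellularity (AsBoolAlg (BoolTensor (CliqueRing G₀) (CliqueRing G₁))) = #W ∧
      ¬ ChainCondition #W (AsBoolAlg (BoolTensor (CliqueRing G₀) (CliqueRing G₁))) := by
  let m : W → BoolTensor (CliqueRing G₀) (CliqueRing G₁) := fun x =>
    BoolTensor.inl (CliqueRing.coord G₀ x) * BoolTensor.inr (CliqueRing.coord G₁ x)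
  refine cellularity_eq_and_not_chainCondition (fun x : W => toBoolAlg (m x)) (fun x h => ?_)
    (fun x y hxy => disjoint_toBoolAlg_iff.2 ?_) fun S _ => ?_
  · have h0 : m x = 0 := toBoolAlg_inj.1 h
    -- Evaluating both factors at the clique `{x}` sends `m x` to 1, so it is not zero.
    have h1 := congrArg (BoolTensor.lift (CliqueRing.eval (FiniteClique.single G₀ x))
      (CliqueRing.eval (FiniteClique.single G₁ x))) h0
    rw [map_mul, BoolTensor.lift_inl, BoolTensor.lift_inr, CliqueRing.eval_single_coord,
      CliqueRing.eval_single_coord, map_zero, mul_one] at h1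
    exact one_ne_zero h1
  · rw [ofBoolAlg_toBoolAlg, ofBoolAlg_toBoolAlg, mul_mul_mul_comm, ← map_mul, ← map_mul]
    by_cases h : G₀.Adj x y
    · rw [CliqueRing.coord_mul_coord (G := G₁) hxy (hdis x y h), map_zero, mul_zero]
    · rw [CliqueRing.coord_mul_coord (G := G₀) hxy h, map_zero, zero_mul]
  · refine (mk_set_le S).trans ((mk_boolTensor_le (R := CliqueRing G₀) (S := CliqueRing G₁)).trans
      (max_le hW ?_))
    exact mul_le_of_le hW ((mk_cliqueRing_le G₀).trans (max_le hW le_rfl))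
      ((mk_cliqueRing_le G₁).trans (max_le hW le_rfl))

end CliqueRing

theorem theorem1p1 :
    Pr1.{0} (Cardinal.aleph 2) (Cardinal.aleph 2) (Cardinal.aleph 2) Cardinal.aleph0 ∧
    (∃ (X Y : Type) (_ : TopologicalSpace X) (_ : TopologicalSpace Y),
      spaceCellularity X = Cardinal.aleph 1 ∧
      spaceCellularity Y = Cardinal.aleph 1 ∧
      spaceCellularity (X × Y) = Cardinal.aleph 2 ∧
      SpaceChainCondition (Cardinal.aleph 2) X ∧
      SpaceChainCondition (Cardinal.aleph 2) Y ∧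
      ¬ SpaceChainCondition (Cardinal.aleph 2) (X × Y)) ∧
    (∃ (A B C : Type) (_ : BooleanAlgebra A) (_ : BooleanAlgebra B) (_ : BooleanAlgebra C)
      (i : BoundedLatticeHom A C) (j : BoundedLatticeHom B C),
      IsFreeProduct i j ∧
      cellularity A = Cardinal.aleph 1 ∧
      cellularity B = Cardinal.aleph 1 ∧
      cellularity C = Cardinal.aleph 2 ∧
      ChainCondition (Cardinal.aleph 2) A ∧
      ChainCondition (Cardinal.aleph 2) B ∧
      ¬ ChainCondition (Cardinal.aleph 2) C) := by
  have hsucc : aleph 2 = Order.succ (aleph 1) := by rw [succ_aleph, one_add_one_eq_two]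
  have hV : IsSuccCardOrder ℵ₀ (aleph 1).ord.ToType :=
    isSuccCardOrder_ord_toType le_rfl succ_aleph0.symm
  have hW : IsSuccCardOrder (aleph 1) (aleph 2).ord.ToType :=
    isSuccCardOrder_ord_toType (aleph0_le_aleph 1) hsucc
  have hWc : #(aleph 2).ord.ToType = aleph 2 := mk_ord_toType _
  have hW0 : ℵ₀ ≤ #(aleph 2).ord.ToType := (aleph0_le_aleph 2).trans_eq hWc.symm
  obtain ⟨c, hc1, hc2⟩ := exists_strong_colouring hW hV (mk_ord_toType _)
  obtain ⟨G₀, G₁, D, hD, h0, h1, hD0, hD1, hdis⟩ := exists_graphs hW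
    (by rw [hWc, hsucc]; exact Order.le_succ _) hc1 hc2
  have hprod := spaceCellularity_prod_finiteClique hW0 hdis
  have hfree := cellularity_boolTensor_cliqueRing hW0 hdis
  rw [hWc] at hprod hfree
  refine ⟨pr1_of_colouring hc1 hc2, ?_, ?_⟩
  · refine ⟨FiniteClique G₀, FiniteClique G₁, inferInstance, inferInstance,
      spaceCellularity_finiteClique hW h0 hD hD0, spaceCellularity_finiteClique hW h1 hD hD1,
      hprod.1, ?_, ?_, hprod.2⟩
    · exact ChainCondition.mono (spaceChainCondition_finiteClique hW h0) hsucc.ge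
    · exact ChainCondition.mono (spaceChainCondition_finiteClique hW h1) hsucc.ge
  · refine ⟨AsBoolAlg (CliqueRing G₀), AsBoolAlg (CliqueRing G₁),
      AsBoolAlg (BoolTensor (CliqueRing G₀) (CliqueRing G₁)), inferInstance, inferInstance,
      inferInstance, _, _, isFreeProduct_boolTensor,
      cellularity_cliqueRing hW h0 hD hD0, cellularity_cliqueRing hW h1 hD hD1, hfree.1,
      ?_, ?_, hfree.2⟩
    · exact (chainCondition_cliqueRing hW h0).mono hsucc.ge
    · exact (chainCondition_cliqueRing hW h1).mono hsucc.ge
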